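/- Let $\Omega=\{(x,y)\in\mathbb{R}^2: 0<x<1,\ 0<y<1\}$, let $\alpha_1,\alpha_2\in(0,\tfrac12)$, $1<p<\infty$, and let $V\in L^p(\Omega)$ with $V\ge 0$ a.e. and $f\in L^2(\Omega)$. Put $$Lu=-\left(y^{2\alpha_1}\partial_x^2u+x^{2\alpha_2}\partial_y^2u\right)+Vu .$$ Let $\mathcal H^1(\Omega)$ be the space of all real-valued $u\in L^2(\Omega)$ with weak derivatives such that $y^{\alpha_1}\partial_xu\in L^2(\Omega)$ and $x^{\alpha_2}\partial_yu\in L^2(\Omega)$, with norm $\|u\|_{\mathcal H^1(\Omega)}=\left(\|u\|_{L^2(\Omega)}^2+\|y^{\alpha_1}\partial_xu\|_{L^2(\Omega)}^2+\|x^{\alpha_2}\partial_yu\|_{L^2(\Omega)}^2\right)^{1/2}$; let $\mathcal H^1_0(\Omega)$ be the closure of $C_0^\infty(\Omega)$ in $\mathcal H^1(\Omega)$, and $H_0(\Omega)=\{u\in\mathcal H^1_0(\Omega):\iint_\Omega Vu^2\,dx\,dy<\infty\}$. A function $u\in H_0(\Omega)$ is a weak solution of $Lu=f$ if $$\iint_\Omega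 (y^{\alpha_1}\partial_xu)(y^{\alpha_1}\partial_xv)+(x^{\alpha_2}\partial_yu)(x^{\alpha_2}\partial_yv)+Vuv\,dx\,dy=\iint_\Omega fv\,dx\,dy\qquad\text{for all } v\in H_0(\Omega).$$ Theorem. For all $M\ge 0$, $s_0\in\Omega$ and $r>0$ such that the closure of the open Euclidean ball $B_{4r}=B_{4r}(s_0)$ is contained in $\Omega$, there is a constant $C>0$, depending only on $\alpha_1,\alpha_2,p,M,s_0,r$, such that for every $V\in L^p(\Omega)$ with $V\ge0$ a.e. and $\|V\|_{L^p(\Omega)}\le M$, every $f\in L^2(\Omega)$ and every weak solution $u\in H_0(\Omega)$ of $Lu=f$, $$\operatorname*{ess\,sup}_{B_r(s_0)}|u|\le C\left(\|u\|_{L^2(B_{2r}(s_0))}+\|f\|_{L^2(\Omega)}\right).$$ -/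

import Mathlib

open MeasureTheory Set Metric
open scoped ENNReal NNReal ContDiff

namespace SubElliptic

/-- The Euclidean plane; a point `s` has coordinates `s 0` (written `x`) and `s 1` (written `y`). -/
abbrev Plane : Type := EuclideanSpace ℝ (Fin 2)

/-- The open unit square `{(x, y) : 0 < x < 1, 0 < y < 1}`. -/
def unitSquare : Set Plane := {s | (0 < s 0 ∧ s 0 < 1) ∧ (0 < s 1 ∧ s 1 < 1)}

/-- Lebesgue measure on the unit square. -/
noncomputable def squareMeasure : Measure Plane := volume.restrict unitSquare

/-- The classical partial derivative of `φ` in the `i`-th coordinate direction. -/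
noncomputable def partialDeriv (i : Fin 2) (φ : Plane → ℝ) (s : Plane) : ℝ :=
  fderiv ℝ φ s (EuclideanSpace.single i 1)

/-- `φ` is a smooth function with compact support contained in the unit square. -/
structure IsTestFunction (φ : Plane → ℝ) : Prop where
  contDiff : ContDiff ℝ ∞ φ
  hasCompactSupport : HasCompactSupport φ
  tsupport_subset : tsupport φ ⊆ unitSquare

/-- `g` is the weak (distributional) `i`-th partial derivative of `u` in the unit square. -/
structure HasWeakDeriv (i : Fin 2) (u g : Plane → ℝ) : Prop where
  locallyIntegrableOn : LocallyIntegrableOn u unitSquare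
  locallyIntegrableOn_deriv : LocallyIntegrableOn g unitSquare
  integral_eq : ∀ φ : Plane → ℝ, IsTestFunction φ →
    ∫ s, u s * partialDeriv i φ s ∂squareMeasure = -∫ s, g s * φ s ∂squareMeasure

theorem isOpen_unitSquare : IsOpen unitSquare := by
  have h : ∀ i : Fin 2, Continuous fun s : Plane => s i := fun i => by fun_prop
  exact ((isOpen_lt continuous_const (h 0)).inter (isOpen_lt (h 0) continuous_const)).inter
    ((isOpen_lt continuous_const (h 1)).inter (isOpen_lt (h 1) continuous_const))

/-- A weak derivative is unique almost everywhere in the unit square. -/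
theorem HasWeakDeriv.ae_unique {i : Fin 2} {u g h : Plane → ℝ}
    (hg : HasWeakDeriv i u g) (hh : HasWeakDeriv i u h) : g =ᵐ[squareMeasure] h := by
  have key : ∀ᵐ s, s ∈ unitSquare → g s - h s = 0 := by
    refine isOpen_unitSquare.ae_eq_zero_of_integral_contDiff_smul_eq_zero
      (f := fun s => g s - h s)
      (hg.locallyIntegrableOn_deriv.sub hh.locallyIntegrableOn_deriv) ?_
    intro φ hφ hc hs
    have ht : IsTestFunction φ := ⟨hφ, hc, hs⟩
    have hint : ∀ k : Plane → ℝ, LocallyIntegrableOn k unitSquare →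
        Integrable (fun s => k s * φ s) := by
      intro k hk
      have h1 : IntegrableOn k (tsupport φ) := hk.integrableOn_compact_subset hs hc
      have h2 : IntegrableOn (fun s => k s * φ s) (tsupport φ) :=
        h1.mul_continuousOn hφ.continuous.continuousOn hc
      refine (integrableOn_iff_integrable_of_support_subset ?_).1 h2
      intro s hs'
      refine subset_tsupport φ fun h0 => hs' ?_
      simp [h0]
    have hset : ∀ k : Plane → ℝ,
        ∫ s, k s * φ s ∂squareMeasure = ∫ s, k s * φ s := by
      intro k
      refine setIntegral_eq_integral_of_forall_compl_eq_zero fun s hs' => ?_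
      rw [image_eq_zero_of_notMem_tsupport fun h0 => hs' (hs h0), mul_zero]
    have e1 := hg.integral_eq φ ht
    rw [hh.integral_eq φ ht, hset, hset, neg_inj] at e1
    calc ∫ s, φ s • (g s - h s) = ∫ s, (g s * φ s - h s * φ s) := by
          congr 1; ext s; simp only [smul_eq_mul]; ring
      _ = 0 := by
          rw [integral_sub (hint g hg.locallyIntegrableOn_deriv)
            (hint h hh.locallyIntegrableOn_deriv), e1, sub_self]
  rw [squareMeasure, Filter.EventuallyEq, ae_restrict_iff' isOpen_unitSquare.measurableSet]
  filter_upwards [key] with s hs hmem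
  exact sub_eq_zero.1 (hs hmem)

open Classical in
/-- The weak `i`-th partial derivative of `u` in the unit square (a chosen representative of it,
unique up to a null set; `0` if there is none). -/
noncomputable def weakDeriv (i : Fin 2) (u : Plane → ℝ) : Plane → ℝ :=
  if h : ∃ g, HasWeakDeriv i u g then h.choose else 0

theorem hasWeakDeriv_weakDeriv {i : Fin 2} {u : Plane → ℝ} (h : ∃ g, HasWeakDeriv i u g) :
    HasWeakDeriv i u (weakDeriv i u) := by
  rw [weakDeriv, dif_pos h]
  exact h.choose_spec

/-- The degenerate derivative `y ^ α₁ * ∂ₓ u`. -/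
noncomputable def degX (α₁ : ℝ) (u : Plane → ℝ) (s : Plane) : ℝ := s 1 ^ α₁ * weakDeriv 0 u s

/-- The degenerate derivative `x ^ α₂ * ∂_y u`. -/
noncomputable def degY (α₂ : ℝ) (u : Plane → ℝ) (s : Plane) : ℝ := s 0 ^ α₂ * weakDeriv 1 u s

/-- Membership in `𝓗¹`: `u`, `y ^ α₁ ∂ₓ u` and `x ^ α₂ ∂_y u` are in `L²` of the unit square. -/
structure MemH1 (α₁ α₂ : ℝ) (u : Plane → ℝ) : Prop where
  memLp : MemLp u 2 squareMeasure
  exists_weakDeriv : ∀ i : Fin 2, ∃ g, HasWeakDeriv i u g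
  memLp_degX : MemLp (degX α₁ u) 2 squareMeasure
  memLp_degY : MemLp (degY α₂ u) 2 squareMeasure

/-- The scalar product of `𝓗¹`. -/
noncomputable def innerH1 (α₁ α₂ : ℝ) (u v : Plane → ℝ) : ℝ :=
  ∫ s, (u s * v s + degX α₁ u s * degX α₁ v s + degY α₂ u s * degY α₂ v s) ∂squareMeasure

/-- The norm of `𝓗¹`. -/
noncomputable def normH1 (α₁ α₂ : ℝ) (u : Plane → ℝ) : ℝ := √(innerH1 α₁ α₂ u u)

/-- Membership in `𝓗¹₀`, the closure of the test functions in `𝓗¹`. -/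
def MemH1Zero (α₁ α₂ : ℝ) (u : Plane → ℝ) : Prop :=
  MemH1 α₁ α₂ u ∧
    ∀ ε : ℝ, 0 < ε → ∃ φ, IsTestFunction φ ∧ normH1 α₁ α₂ (fun s => u s - φ s) < ε

/-- Membership in `H₀`: `u` is in `𝓗¹₀` and the integral of `V u²` is finite. -/
def MemHZero (α₁ α₂ : ℝ) (V u : Plane → ℝ) : Prop :=
  MemH1Zero α₁ α₂ u ∧ Integrable (fun s => V s * u s ^ 2) squareMeasure

/-- The bilinear form of `L = -(y ^ (2 α₁) ∂ₓ² + x ^ (2 α₂) ∂_y²) + V`. -/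
noncomputable def bilinForm (α₁ α₂ : ℝ) (V u v : Plane → ℝ) : ℝ :=
  ∫ s, (degX α₁ u s * degX α₁ v s + degY α₂ u s * degY α₂ v s + V s * u s * v s) ∂squareMeasure

/-- `u` is a weak solution in `H₀` of `L u = f` in the unit square. -/
def IsWeakSolution (α₁ α₂ : ℝ) (V f u : Plane → ℝ) : Prop :=
  MemHZero α₁ α₂ V u ∧
    ∀ v, MemHZero α₁ α₂ V v → bilinForm α₁ α₂ V u v = ∫ s, f s * v s ∂squareMeasure

end SubElliptic

/-!
Away from the coordinate axes the operator is uniformly elliptic with smooth coefficients, and the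
local bound for `|u|` follows from a mean value inequality that is proved by inserting explicit
test functions; no iteration is needed.

First, Kato's inequality `-(y ^ (2 α₁) ∂ₓ² + x ^ (2 α₂) ∂_y²) |u| ≤ |f|` holds in the sense of
distributions (`IsWeakSolution.integral_abs_le`). It comes from testing the equation with
`φ K'(u)`, where `K` is a smooth convex approximation of the absolute value: the second order terms
give the operator applied to `K(u)` and a term with `K''` that has a sign, and the potential
contributes `V u K'(u) φ ≥ 0`, which is dropped. To avoid a chain rule for weak derivatives, the
test functions actually inserted are `φ K'(ψₙ)` for smooth `ψₙ → u` in `𝓗¹`, so that every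
derivative taken is classical (`IsWeakSolution.integral_convex_comp_le`).

Secondly, for a pole `z` let `q` be the squared distance to `z` in the metric of the coefficients
frozen at `z`, plus `ε²`. Up to a smooth cutoff, the barrier is
`φ = 2 - ½ log q - (2 / r) √q` (`profile`). The logarithm is the regularised fundamental solution of
the frozen operator, for which minus the operator is `2 ε² / q²`, an approximate identity. The true
coefficients differ from the frozen ones by a relative amount at most `√q / (3 r)`, which costs
`O(1 / √q)`, and the term in `√q` compensates for exactly this (`barrier_inequality`). The cutoff
costs a bounded error only (`exists_barrier`). Since the logarithm is square integrable in the
plane, the barriers are bounded in `L²`, uniformly in `z` and `ε`.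

Kato's inequality against the barrier then bounds the mean of `|u|` over the ball of radius `ε`
around `z` by `C (‖u‖ + ‖f‖)`, with `C` independent of `z` and `ε`, and the Lebesgue
differentiation theorem turns this into a bound for `|u z|` at almost every `z`
(`exists_forall_ae_abs_le`).
-/

namespace SubElliptic

open Filter Topology

/-! ### Test functions and their classical derivatives -/

instance : IsFiniteMeasure squareMeasure := by
  refine ⟨?_⟩
  rw [squareMeasure, Measure.restrict_apply_univ]
  refine Bornology.IsBounded.measure_lt_top
    ((Metric.isBounded_closedBall (x := (0 : Plane)) (r := 2)).subset fun s hs => ?_)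
  rw [mem_closedBall_zero_iff, EuclideanSpace.norm_eq]
  refine Real.sqrt_le_iff.2 ⟨by norm_num, ?_⟩
  obtain ⟨⟨h1, h2⟩, h3, h4⟩ := hs
  simp only [Fin.sum_univ_two, Real.norm_eq_abs, sq_abs]
  nlinarith

theorem ae_mem_unitSquare : ∀ᵐ s ∂squareMeasure, s ∈ unitSquare :=
  ae_restrict_mem isOpen_unitSquare.measurableSet

theorem pos_of_mem_unitSquare {s : Plane} (hs : s ∈ unitSquare) (i : Fin 2) : 0 < s i := by
  fin_cases i
  exacts [hs.1.1, hs.2.1]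

theorem lt_one_of_mem_unitSquare {s : Plane} (hs : s ∈ unitSquare) (i : Fin 2) : s i < 1 := by
  fin_cases i
  exacts [hs.1.2, hs.2.2]

theorem integral_squareMeasure_eq {k : Plane → ℝ} (hk : ∀ s ∉ unitSquare, k s = 0) :
    ∫ s, k s ∂squareMeasure = ∫ s, k s :=
  setIntegral_eq_integral_of_forall_compl_eq_zero hk

/-- A locally integrable function on the square times a test function is integrable. -/
theorem IsTestFunction.integrable_locallyIntegrableOn_mul {φ k : Plane → ℝ}
    (hφ : IsTestFunction φ) (hk : LocallyIntegrableOn k unitSquare) :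
    Integrable fun s => k s * φ s := by
  have h1 : IntegrableOn k (tsupport φ) :=
    hk.integrableOn_compact_subset hφ.tsupport_subset hφ.hasCompactSupport
  refine (integrableOn_iff_integrable_of_support_subset fun s hs' => ?_).1
    (h1.mul_continuousOn hφ.contDiff.continuous.continuousOn hφ.hasCompactSupport)
  exact subset_tsupport φ fun h0 => hs' (by simp [h0])

theorem IsTestFunction.eq_zero {φ : Plane → ℝ} (hφ : IsTestFunction φ) {s : Plane}
    (hs : s ∉ unitSquare) : φ s = 0 :=
  image_eq_zero_of_notMem_tsupport fun h => hs (hφ.tsupport_subset h)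

theorem IsTestFunction.differentiable {φ : Plane → ℝ} (hφ : IsTestFunction φ) :
    Differentiable ℝ φ := hφ.contDiff.differentiable (by simp)

theorem IsTestFunction.exists_bound {φ : Plane → ℝ} (hφ : IsTestFunction φ) :
    ∃ B, 0 ≤ B ∧ ∀ s, |φ s| ≤ B := by
  obtain ⟨B, hB⟩ := hφ.hasCompactSupport.exists_bound_of_continuous hφ.contDiff.continuous
  exact ⟨B, (norm_nonneg _).trans (hB 0), hB⟩

theorem IsTestFunction.memLp {φ : Plane → ℝ} (hφ : IsTestFunction φ) (p : ℝ≥0∞) :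
    MemLp φ p squareMeasure := by
  obtain ⟨B, -, hB⟩ := hφ.exists_bound
  exact MemLp.of_bound hφ.contDiff.continuous.aestronglyMeasurable B (.of_forall hB)

theorem IsTestFunction.partialDeriv {φ : Plane → ℝ} (hφ : IsTestFunction φ) (i : Fin 2) :
    IsTestFunction (partialDeriv i φ) where
  contDiff := (hφ.contDiff.fderiv_right (m := ∞) (by simp)).clm_apply contDiff_const
  hasCompactSupport := hφ.hasCompactSupport.fderiv_apply ℝ _
  tsupport_subset := (tsupport_fderiv_apply_subset ℝ _).trans hφ.tsupport_subset

theorem IsTestFunction.mul_left {φ c : Plane → ℝ} (hφ : IsTestFunction φ)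
    (hc : ∀ s ∈ unitSquare, ContDiffAt ℝ ∞ c s) : IsTestFunction fun s => c s * φ s where
  contDiff := contDiff_iff_contDiffAt.2 fun s => by
    by_cases hs : s ∈ tsupport φ
    · exact (hc s (hφ.tsupport_subset hs)).mul hφ.contDiff.contDiffAt
    · refine (contDiffAt_const (c := (0 : ℝ))).congr_of_eventuallyEq ?_
      filter_upwards [notMem_tsupport_iff_eventuallyEq.1 hs] with t ht
      rw [ht, Pi.zero_apply, mul_zero]
  hasCompactSupport := hφ.hasCompactSupport.mul_left
  tsupport_subset := tsupport_mul_subset_right.trans hφ.tsupport_subset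

theorem IsTestFunction.comp_left {φ : Plane → ℝ} (hφ : IsTestFunction φ) {K : ℝ → ℝ}
    (hK : ContDiff ℝ ∞ K) (hK0 : K 0 = 0) : IsTestFunction fun s => K (φ s) where
  contDiff := hK.comp hφ.contDiff
  hasCompactSupport := hφ.hasCompactSupport.comp_left hK0
  tsupport_subset :=
    (closure_mono (Function.support_comp_subset hK0 φ)).trans hφ.tsupport_subset

theorem partialDeriv_comp {φ : Plane → ℝ} {K : ℝ → ℝ} {s : Plane} (i : Fin 2)
    (hK : DifferentiableAt ℝ K (φ s)) (hφ : DifferentiableAt ℝ φ s) :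
    partialDeriv i (fun t => K (φ t)) s = deriv K (φ s) * partialDeriv i φ s := by
  have := (hK.hasDerivAt.comp_hasFDerivAt s hφ.hasFDerivAt).fderiv
  simp only [partialDeriv]
  rw [show (fun t => K (φ t)) = K ∘ φ from rfl, this]
  simp

theorem partialDeriv_mul {φ ψ : Plane → ℝ} {s : Plane} (i : Fin 2)
    (hφ : DifferentiableAt ℝ φ s) (hψ : DifferentiableAt ℝ ψ s) :
    partialDeriv i (fun t => φ t * ψ t) s =
      φ s * partialDeriv i ψ s + partialDeriv i φ s * ψ s := by
  simp only [partialDeriv]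
  rw [fderiv_fun_mul hφ hψ]
  simp [mul_comm]

theorem partialDeriv_coord (i j : Fin 2) (s : Plane) :
    partialDeriv i (fun t : Plane => t j) s = if i = j then 1 else 0 := by
  simp only [partialDeriv]
  rw [show (fun t : Plane => t j) = (EuclideanSpace.proj j : Plane →L[ℝ] ℝ) from rfl,
    ContinuousLinearMap.fderiv]
  simp [eq_comm]

theorem partialDeriv_coord_rpow {s : Plane} (hs : s ∈ unitSquare) {i j : Fin 2} (hij : i ≠ j)
    (a : ℝ) : partialDeriv i (fun t => t j ^ a) s = 0 := by
  have h : DifferentiableAt ℝ (fun t : Plane => t j) s := by fun_prop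
  rw [partialDeriv_comp i
    (Real.differentiableAt_rpow_const_of_ne a (pos_of_mem_unitSquare hs j).ne') h]
  rw [partialDeriv_coord, if_neg hij, mul_zero]

theorem contDiffAt_coord_rpow {s : Plane} (hs : s ∈ unitSquare) (j : Fin 2) (a : ℝ) :
    ContDiffAt ℝ ∞ (fun t : Plane => t j ^ a) s := by
  have h : ContDiffAt ℝ ∞ (fun t : Plane => t j) s :=
    (EuclideanSpace.proj j : Plane →L[ℝ] ℝ).contDiff.contDiffAt
  exact h.rpow_const_of_ne (pos_of_mem_unitSquare hs j).ne'

/-! ### Weak derivatives of test functions -/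

theorem IsTestFunction.hasWeakDeriv {φ : Plane → ℝ} (hφ : IsTestFunction φ) (i : Fin 2) :
    HasWeakDeriv i φ (SubElliptic.partialDeriv i φ) where
  locallyIntegrableOn := hφ.contDiff.continuous.locallyIntegrable.locallyIntegrableOn _
  locallyIntegrableOn_deriv :=
    (hφ.partialDeriv i).contDiff.continuous.locallyIntegrable.locallyIntegrableOn _
  integral_eq ψ hψ := by
    have hli : ∀ {k : Plane → ℝ}, IsTestFunction k → LocallyIntegrableOn k unitSquare :=
      fun hk => hk.contDiff.continuous.locallyIntegrable.locallyIntegrableOn _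
    rw [integral_squareMeasure_eq fun s hs => by rw [hφ.eq_zero hs, zero_mul],
      integral_squareMeasure_eq fun s hs => by rw [hψ.eq_zero hs, mul_zero]]
    exact integral_mul_fderiv_eq_neg_fderiv_mul_of_integrable
      (hψ.integrable_locallyIntegrableOn_mul (hli (hφ.partialDeriv i)))
      ((hψ.partialDeriv i).integrable_locallyIntegrableOn_mul (hli hφ))
      (hψ.integrable_locallyIntegrableOn_mul (hli hφ))
      (fun _ _ => hφ.differentiable _) fun _ _ => hψ.differentiable _

theorem HasWeakDeriv.weakDeriv_ae_eq {i : Fin 2} {u g : Plane → ℝ} (h : HasWeakDeriv i u g) :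
    weakDeriv i u =ᵐ[squareMeasure] g :=
  (hasWeakDeriv_weakDeriv ⟨g, h⟩).ae_unique h

theorem HasWeakDeriv.sub {i : Fin 2} {u v g h : Plane → ℝ} (hu : HasWeakDeriv i u g)
    (hv : HasWeakDeriv i v h) :
    HasWeakDeriv i (fun s => u s - v s) fun s => g s - h s where
  locallyIntegrableOn := hu.locallyIntegrableOn.sub hv.locallyIntegrableOn
  locallyIntegrableOn_deriv := hu.locallyIntegrableOn_deriv.sub hv.locallyIntegrableOn_deriv
  integral_eq φ hφ := by
    have hI : ∀ {k ψ : Plane → ℝ}, LocallyIntegrableOn k unitSquare → IsTestFunction ψ →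
        Integrable (fun s => k s * ψ s) squareMeasure :=
      fun hk hψ => (hψ.integrable_locallyIntegrableOn_mul hk).restrict
    simp only [sub_mul]
    rw [integral_sub (hI hu.locallyIntegrableOn (hφ.partialDeriv i))
        (hI hv.locallyIntegrableOn (hφ.partialDeriv i)),
      integral_sub (hI hu.locallyIntegrableOn_deriv hφ) (hI hv.locallyIntegrableOn_deriv hφ),
      hu.integral_eq φ hφ, hv.integral_eq φ hφ]
    ring

theorem IsTestFunction.degX_ae_eq {φ : Plane → ℝ} (hφ : IsTestFunction φ) (α : ℝ) :
    degX α φ =ᵐ[squareMeasure] fun s => s 1 ^ α * SubElliptic.partialDeriv 0 φ s := by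
  filter_upwards [(hφ.hasWeakDeriv 0).weakDeriv_ae_eq] with s hs
  rw [degX, hs]

theorem IsTestFunction.degY_ae_eq {φ : Plane → ℝ} (hφ : IsTestFunction φ) (α : ℝ) :
    degY α φ =ᵐ[squareMeasure] fun s => s 0 ^ α * SubElliptic.partialDeriv 1 φ s := by
  filter_upwards [(hφ.hasWeakDeriv 1).weakDeriv_ae_eq] with s hs
  rw [degY, hs]

theorem IsTestFunction.rpow_mul_partialDeriv {φ : Plane → ℝ} (hφ : IsTestFunction φ) (α : ℝ)
    (i j : Fin 2) : IsTestFunction fun s => s j ^ α * SubElliptic.partialDeriv i φ s :=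
  (hφ.partialDeriv i).mul_left fun _ hs => contDiffAt_coord_rpow hs j α

theorem IsTestFunction.memH1 {φ : Plane → ℝ} (hφ : IsTestFunction φ) (α₁ α₂ : ℝ) :
    MemH1 α₁ α₂ φ where
  memLp := hφ.memLp 2
  exists_weakDeriv i := ⟨_, hφ.hasWeakDeriv i⟩
  memLp_degX := ((hφ.rpow_mul_partialDeriv α₁ 0 1).memLp 2).ae_eq (hφ.degX_ae_eq α₁).symm
  memLp_degY := ((hφ.rpow_mul_partialDeriv α₂ 1 0).memLp 2).ae_eq (hφ.degY_ae_eq α₂).symm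

theorem isTestFunction_zero : IsTestFunction fun _ => (0 : ℝ) where
  contDiff := contDiff_const
  hasCompactSupport := HasCompactSupport.zero
  tsupport_subset := by simp [tsupport, Function.support]

theorem normH1_zero (α₁ α₂ : ℝ) : normH1 α₁ α₂ (fun _ => 0) = 0 := by
  rw [normH1, innerH1, integral_eq_zero_of_ae, Real.sqrt_zero]
  filter_upwards [isTestFunction_zero.degX_ae_eq α₁, isTestFunction_zero.degY_ae_eq α₂]
    with s h1 h2
  rw [h1, h2]
  simp [partialDeriv]

/-- Test functions are bounded, so an integrable potential suffices for them to lie in `H₀`. -/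
theorem IsTestFunction.memHZero {φ V : Plane → ℝ} (hφ : IsTestFunction φ) (α₁ α₂ : ℝ)
    (hV : Integrable V squareMeasure) : MemHZero α₁ α₂ V φ := by
  refine ⟨⟨hφ.memH1 α₁ α₂, fun ε hε => ⟨φ, hφ, ?_⟩⟩, ?_⟩
  · simpa only [sub_self, normH1_zero] using hε
  · obtain ⟨B, hB0, hB⟩ := hφ.exists_bound
    refine hV.mul_bdd (c := B ^ 2) (hφ.contDiff.continuous.pow 2).aestronglyMeasurable
      (.of_forall fun s => ?_)
    rw [norm_pow]
    exact pow_le_pow_left₀ (norm_nonneg _) (hB s) 2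

/-! ### Convergence in `L²` -/

theorem abs_integral_mul_le_eLpNorm_mul_eLpNorm {μ : Measure Plane} {F G : Plane → ℝ}
    (hF : MemLp F 2 μ) (hG : MemLp G 2 μ) :
    |∫ s, F s * G s ∂μ| ≤ (eLpNorm F 2 μ).toReal * (eLpNorm G 2 μ).toReal := by
  have h := eLpNorm_smul_le_mul_eLpNorm (p := 2) (q := 2) (r := 1) hG.1 hF.1
  rw [← ENNReal.toReal_mul]
  refine le_trans ?_ (ENNReal.toReal_mono (ENNReal.mul_ne_top hF.2.ne hG.2.ne) h)
  rw [eLpNorm_one_eq_lintegral_enorm, ← Real.norm_eq_abs]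
  have := norm_integral_le_lintegral_norm (μ := μ) (F • G)
  simpa only [ofReal_norm, Pi.smul_apply', smul_eq_mul] using this

/-- If `Fₙ → F` in `L²` and `Hₙ` is dominated by `|Fₙ - F| |G|` with `G` in `L²`, then the
integrals of `Hₙ` tend to zero. -/
theorem tendsto_integral_zero_of_abs_le_sub_mul {μ : Measure Plane} {F G : Plane → ℝ}
    {Fn H : ℕ → Plane → ℝ} (hF : MemLp F 2 μ) (hFn : ∀ n, MemLp (Fn n) 2 μ) (hG : MemLp G 2 μ)
    (hlim : Tendsto (fun n => eLpNorm (fun s => Fn n s - F s) 2 μ) atTop (𝓝 0))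
    (hH : ∀ n, ∀ᵐ s ∂μ, |H n s| ≤ |Fn n s - F s| * |G s|) :
    Tendsto (fun n => ∫ s, H n s ∂μ) atTop (𝓝 0) := by
  have hsub : ∀ n, MemLp (fun s => Fn n s - F s) 2 μ := fun n => (hFn n).sub hF
  have hb : ∀ n, ‖∫ s, H n s ∂μ‖ ≤
      (eLpNorm (fun s => Fn n s - F s) 2 μ).toReal * (eLpNorm G 2 μ).toReal := by
    intro n
    have hi : Integrable (fun s => |Fn n s - F s| * |G s|) μ :=
      (hsub n).abs.integrable_mul hG.abs
    refine (norm_integral_le_of_norm_le hi (hH n)).trans ?_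
    have := abs_integral_mul_le_eLpNorm_mul_eLpNorm (hsub n).abs hG.abs
    have e : ∀ k : Plane → ℝ, eLpNorm (fun s => |k s|) 2 μ = eLpNorm k 2 μ :=
      fun k => eLpNorm_norm k
    simp only [e, Pi.abs_def] at this
    exact (le_abs_self _).trans this
  refine squeeze_zero_norm hb ?_
  have h0 := (ENNReal.tendsto_toReal ENNReal.zero_ne_top).comp hlim
  simpa using h0.mul_const (eLpNorm G 2 μ).toReal

theorem tendsto_eLpNorm_two_zero {μ : Measure Plane} {F : ℕ → Plane → ℝ}
    (hF : ∀ n, MemLp (F n) 2 μ) (h : Tendsto (fun n => ∫ s, F n s ^ 2 ∂μ) atTop (𝓝 0)) :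
    Tendsto (fun n => eLpNorm (F n) 2 μ) atTop (𝓝 0) := by
  have e : ∀ n, eLpNorm (F n) 2 μ = ENNReal.ofReal ((∫ s, F n s ^ 2 ∂μ) ^ (2⁻¹ : ℝ)) := by
    intro n
    rw [(hF n).eLpNorm_eq_integral_rpow_norm (by norm_num) (by norm_num)]
    simp
  simp only [e]
  have := (ENNReal.continuous_ofReal.tendsto _).comp
    (h.rpow_const (p := (2⁻¹ : ℝ)) (Or.inr (by norm_num)))
  simpa [Function.comp_def] using this

/-- An element of `𝓗¹₀` is approximated by test functions in `L²` and almost everywhere, together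
with its two degenerate derivatives in `L²`. -/
theorem MemH1Zero.exists_seq {α₁ α₂ : ℝ} {u : Plane → ℝ} (hu : MemH1Zero α₁ α₂ u) :
    ∃ φ : ℕ → Plane → ℝ, (∀ n, IsTestFunction (φ n)) ∧
      Tendsto (fun n => eLpNorm (fun s => φ n s - u s) 2 squareMeasure) atTop (𝓝 0) ∧
      Tendsto (fun n => eLpNorm (fun s => degX α₁ (φ n) s - degX α₁ u s) 2 squareMeasure)
        atTop (𝓝 0) ∧
      Tendsto (fun n => eLpNorm (fun s => degY α₂ (φ n) s - degY α₂ u s) 2 squareMeasure)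
        atTop (𝓝 0) ∧
      ∀ᵐ s ∂squareMeasure, Tendsto (fun n => φ n s) atTop (𝓝 (u s)) := by
  have hpos : ∀ n : ℕ, (0 : ℝ) < 1 / (n + 1) := fun n => by positivity
  choose φ hφ hlt using fun n : ℕ => hu.2 _ (hpos n)
  have hX : ∀ n, MemLp (fun s => degX α₁ (φ n) s - degX α₁ u s) 2 squareMeasure :=
    fun n => ((hφ n).memH1 α₁ α₂).memLp_degX.sub hu.1.memLp_degX
  have hY : ∀ n, MemLp (fun s => degY α₂ (φ n) s - degY α₂ u s) 2 squareMeasure :=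
    fun n => ((hφ n).memH1 α₁ α₂).memLp_degY.sub hu.1.memLp_degY
  have h0 : ∀ n, MemLp (fun s => φ n s - u s) 2 squareMeasure :=
    fun n => ((hφ n).memLp 2).sub hu.1.memLp
  have hwd : ∀ n i, weakDeriv i (fun s => u s - φ n s) =ᵐ[squareMeasure]
      fun s => weakDeriv i u s - weakDeriv i (φ n) s := fun n i =>
    ((hasWeakDeriv_weakDeriv (hu.1.exists_weakDeriv i)).sub
      (hasWeakDeriv_weakDeriv ⟨_, (hφ n).hasWeakDeriv i⟩)).weakDeriv_ae_eq
  set I : ℕ → ℝ := fun n => ∫ s, ((φ n s - u s) ^ 2 + (degX α₁ (φ n) s - degX α₁ u s) ^ 2 +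
    (degY α₂ (φ n) s - degY α₂ u s) ^ 2) ∂squareMeasure with hI
  have hIeq : ∀ n, normH1 α₁ α₂ (fun s => u s - φ n s) = √(I n) := by
    intro n
    rw [normH1, innerH1]
    congr 1
    refine integral_congr_ae ?_
    filter_upwards [hwd n 0, hwd n 1] with s h1 h2
    simp only [degX, degY, h1, h2]
    ring
  have hIlt : ∀ n, I n ≤ 1 / ((n : ℝ) + 1) := by
    intro n
    have h1 := hlt n
    rw [hIeq, Real.sqrt_lt' (hpos n)] at h1
    have h2 : (1 : ℝ) / (n + 1) ≤ 1 := by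
      rw [div_le_one (by positivity)]; linarith [n.cast_nonneg (α := ℝ)]
    nlinarith [hpos n]
  have hmain : ∀ F : ℕ → Plane → ℝ, (∀ n, MemLp (F n) 2 squareMeasure) →
      (∀ n s, F n s ^ 2 ≤ (φ n s - u s) ^ 2 + (degX α₁ (φ n) s - degX α₁ u s) ^ 2 +
        (degY α₂ (φ n) s - degY α₂ u s) ^ 2) →
      Tendsto (fun n => eLpNorm (F n) 2 squareMeasure) atTop (𝓝 0) := by
    intro F hF hle
    refine tendsto_eLpNorm_two_zero hF (squeeze_zero (fun n => integral_nonneg fun s =>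
      sq_nonneg _) (fun n => ?_) tendsto_one_div_add_atTop_nhds_zero_nat)
    exact (integral_mono (hF n).integrable_sq
      (((h0 n).integrable_sq.add (hX n).integrable_sq).add (hY n).integrable_sq)
      (hle n)).trans (hIlt n)
  have t0 := hmain _ h0 fun n s => by
    nlinarith [sq_nonneg (degX α₁ (φ n) s - degX α₁ u s), sq_nonneg (degY α₂ (φ n) s - degY α₂ u s)]
  have tX := hmain _ hX fun n s => by
    nlinarith [sq_nonneg (φ n s - u s), sq_nonneg (degY α₂ (φ n) s - degY α₂ u s)]
  have tY := hmain _ hY fun n s => by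
    nlinarith [sq_nonneg (φ n s - u s), sq_nonneg (degX α₁ (φ n) s - degX α₁ u s)]
  obtain ⟨ns, hns, hae⟩ := (tendstoInMeasure_of_tendsto_eLpNorm (by norm_num)
    (fun n => ((hφ n).memLp 2).1) hu.1.memLp.1 t0).exists_seq_tendsto_ae
  exact ⟨fun n => φ (ns n), fun n => hφ _, t0.comp hns.tendsto_atTop, tX.comp hns.tendsto_atTop,
    tY.comp hns.tendsto_atTop, hae⟩

/-! ### Kato's inequality -/

/-- The principal part `y ^ (2 α₁) ∂ₓ² φ + x ^ (2 α₂) ∂_y² φ`, with classical derivatives. -/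
noncomputable def principalPart (α₁ α₂ : ℝ) (φ : Plane → ℝ) (s : Plane) : ℝ :=
  s 1 ^ (2 * α₁) * partialDeriv 0 (partialDeriv 0 φ) s +
    s 0 ^ (2 * α₂) * partialDeriv 1 (partialDeriv 1 φ) s

theorem IsTestFunction.rpow_mul_partialDeriv_partialDeriv {φ : Plane → ℝ} (hφ : IsTestFunction φ)
    (a : ℝ) (i j : Fin 2) : IsTestFunction fun s =>
      s j ^ a * SubElliptic.partialDeriv i (SubElliptic.partialDeriv i φ) s :=
  (hφ.partialDeriv i).rpow_mul_partialDeriv a i j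

theorem IsTestFunction.memLp_principalPart {φ : Plane → ℝ} (hφ : IsTestFunction φ)
    (α₁ α₂ : ℝ) (p : ℝ≥0∞) : MemLp (principalPart α₁ α₂ φ) p squareMeasure :=
  ((hφ.rpow_mul_partialDeriv_partialDeriv (2 * α₁) 0 1).memLp p).add
    ((hφ.rpow_mul_partialDeriv_partialDeriv (2 * α₂) 1 0).memLp p)

/-- The weight does not depend on the variable of differentiation, so integration by parts
produces no derivative of it. -/
theorem integral_deg_mul_eq {φ ψ : Plane → ℝ} {K : ℝ → ℝ} (hφ : IsTestFunction φ)
    (hψ : IsTestFunction ψ) (hK : ContDiff ℝ ∞ K) (hK0 : K 0 = 0) {i j : Fin 2} (hij : i ≠ j)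
    (α : ℝ) :
    ∫ s, (s j ^ α * partialDeriv i ψ s) * (deriv K (ψ s) * (s j ^ α * partialDeriv i φ s))
        ∂squareMeasure =
      -∫ s, K (ψ s) * (s j ^ (2 * α) * partialDeriv i (partialDeriv i φ) s) ∂squareMeasure := by
  have h := ((hψ.comp_left hK hK0).hasWeakDeriv i).integral_eq _
    (hφ.rpow_mul_partialDeriv (2 * α) i j)
  rw [eq_neg_iff_add_eq_zero, add_comm, ← eq_neg_iff_add_eq_zero]
  refine Eq.trans (integral_congr_ae ?_) (h.trans (congrArg _ (integral_congr_ae ?_)))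
  · filter_upwards [ae_mem_unitSquare] with s hs
    rw [partialDeriv_mul i ((contDiffAt_coord_rpow hs j _).differentiableAt (by simp))
      ((hφ.partialDeriv i).differentiable s), partialDeriv_coord_rpow hs hij, zero_mul, add_zero]
  · filter_upwards [ae_mem_unitSquare] with s hs
    rw [partialDeriv_comp i (hK.differentiable (by simp) _) (hψ.differentiable s), two_mul,
      Real.rpow_add (pos_of_mem_unitSquare hs j)]
    ring

/-- Lower semicontinuity of one component of the energy. Here `D` is a derivative of the solution,
`Dₙ → D` in `L²`, and `Wₙ = kₙ A + φ mₙ Dₙ` is the derivative of a test function; the term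
`φ mₙ D²` that appears in the limit has a sign and is dropped. -/
theorem exists_error_le_integral_mul {μ : Measure Plane} {D A φ : Plane → ℝ}
    {Dn k m W : ℕ → Plane → ℝ} {C B : ℝ} (hD : MemLp D 2 μ) (hDn : ∀ n, MemLp (Dn n) 2 μ)
    (hA : MemLp A 2 μ) (hφm : AEStronglyMeasurable φ μ) (hφ0 : ∀ s, 0 ≤ φ s) (hφB : ∀ s, φ s ≤ B)
    (hlim : Tendsto (fun n => eLpNorm (fun s => Dn n s - D s) 2 μ) atTop (𝓝 0))
    (hkm : ∀ n, AEStronglyMeasurable (k n) μ) (hk : ∀ n s, |k n s| ≤ 1)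
    (hm0 : ∀ n s, 0 ≤ m n s) (hmC : ∀ n s, m n s ≤ C) (hWm : ∀ n, MemLp (W n) 2 μ)
    (hW : ∀ n, ∀ᵐ s ∂μ, W n s = k n s * A s + φ s * m n s * Dn n s) :
    ∃ e : ℕ → ℝ, Tendsto e atTop (𝓝 0) ∧
      ∀ n, ∫ s, Dn n s * (k n s * A s) ∂μ - e n ≤ ∫ s, D s * W n s ∂μ := by
  have hkA : ∀ n, MemLp (fun s => k n s * A s) 2 μ := fun n =>
    hA.mono ((hkm n).mul hA.1) (.of_forall fun s => by
      rw [norm_mul]; exact mul_le_of_le_one_left (norm_nonneg _) (hk n s))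
  have hφD : MemLp (fun s => φ s * D s) 2 μ :=
    MemLp.of_le_mul (c := B) hD (hφm.mul hD.1) (.of_forall fun s => by
      rw [norm_mul, Real.norm_of_nonneg (hφ0 s)]
      exact mul_le_mul_of_nonneg_right (hφB s) (norm_nonneg _))
  have hG : MemLp (fun s => |A s| + C * |φ s * D s|) 2 μ := hA.abs.add (hφD.abs.const_mul C)
  have hsub : ∀ n, MemLp (fun s => Dn n s - D s) 2 μ := fun n => (hDn n).sub hD
  refine ⟨fun n => ∫ s, |Dn n s - D s| * (|A s| + C * |φ s * D s|) ∂μ,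
    tendsto_integral_zero_of_abs_le_sub_mul hD hDn hG hlim fun n => .of_forall fun s => ?_,
    fun n => ?_⟩
  · rw [abs_mul, abs_abs]
  have i1 : Integrable (fun s => Dn n s * (k n s * A s)) μ := (hDn n).integrable_mul (hkA n)
  have i2 : Integrable (fun s => |Dn n s - D s| * (|A s| + C * |φ s * D s|)) μ :=
    (hsub n).abs.integrable_mul hG
  rw [← integral_sub i1 i2]
  refine integral_mono_ae (i1.sub i2) (hD.integrable_mul (hWm n)) ?_
  filter_upwards [hW n] with s hs
  rw [hs]
  have a1 : (Dn n s - D s) * (k n s * A s) ≤ |Dn n s - D s| * |A s| := by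
    refine (le_abs_self _).trans ?_
    rw [abs_mul, abs_mul]
    exact mul_le_mul_of_nonneg_left (mul_le_of_le_one_left (abs_nonneg _) (hk n s))
      (abs_nonneg _)
  have a2 : -((Dn n s - D s) * (m n s * (φ s * D s))) ≤
      |Dn n s - D s| * (C * |φ s * D s|) := by
    refine (neg_le_abs _).trans ?_
    rw [abs_mul, abs_mul, abs_of_nonneg (hm0 n s)]
    exact mul_le_mul_of_nonneg_left (mul_le_mul_of_nonneg_right (hmC n s) (abs_nonneg _))
      (abs_nonneg _)
  have a3 : 0 ≤ φ s * m n s * D s ^ 2 := mul_nonneg (mul_nonneg (hφ0 s) (hm0 n s)) (sq_nonneg _)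
  simp only [mul_add]
  linarith

/-- A regularised Kato inequality: if `K` is convex and smooth with `K(0) = 0` and `|K'| ≤ 1`, then
`-(y ^ (2 α₁) ∂ₓ² + x ^ (2 α₂) ∂_y²) K(u) ≤ |f|` in the sense of distributions. -/
theorem IsWeakSolution.integral_convex_comp_le {α₁ α₂ : ℝ} {V f u : Plane → ℝ}
    (hV : Integrable V squareMeasure) (hV0 : ∀ᵐ s ∂squareMeasure, 0 ≤ V s)
    (hf : MemLp f 2 squareMeasure) (hu : IsWeakSolution α₁ α₂ V f u)
    {K : ℝ → ℝ} {C : ℝ} (hK : ContDiff ℝ ∞ K) (hK0 : K 0 = 0) (hK1 : ∀ t, |deriv K t| ≤ 1)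
    (hKt : ∀ t, 0 ≤ t * deriv K t) (hK2 : ∀ t, 0 ≤ deriv (deriv K) t)
    (hKC : ∀ t, deriv (deriv K) t ≤ C) {φ : Plane → ℝ} (hφ : IsTestFunction φ)
    (hφ0 : ∀ s, 0 ≤ φ s) :
    -∫ s, K (u s) * principalPart α₁ α₂ φ s ∂squareMeasure ≤
      ∫ s, |f s| * φ s ∂squareMeasure := by
  obtain ⟨ψ, hψ, t0, tX, tY, tae⟩ := hu.1.1.exists_seq
  have hK' : ContDiff ℝ ∞ (deriv K) := (contDiff_infty_iff_deriv.1 hK).2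
  have hu2 := hu.1.1.1
  obtain ⟨B, hB0, hB⟩ := hφ.exists_bound
  have hkc : ∀ n, ContDiff ℝ ∞ fun s => deriv K (ψ n s) := fun n => hK'.comp (hψ n).contDiff
  have hkm : ∀ n, AEStronglyMeasurable (fun s => deriv K (ψ n s)) squareMeasure :=
    fun n => (hkc n).continuous.aestronglyMeasurable
  have hv : ∀ n, IsTestFunction fun s => deriv K (ψ n s) * φ s :=
    fun n => hφ.mul_left fun s _ => (hkc n).contDiffAt
  have hvH := fun n => (hv n).memH1 α₁ α₂
  have hpd : ∀ n i s, partialDeriv i (fun s => deriv K (ψ n s) * φ s) s =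
      deriv K (ψ n s) * partialDeriv i φ s +
        deriv (deriv K) (ψ n s) * partialDeriv i (ψ n) s * φ s := by
    intro n i s
    rw [partialDeriv_mul i ((hkc n).differentiable (by simp) s) (hφ.differentiable s),
      partialDeriv_comp i (hK'.differentiable (by simp) _) ((hψ n).differentiable s)]
  have hWX : ∀ n, ∀ᵐ s ∂squareMeasure, degX α₁ (fun s => deriv K (ψ n s) * φ s) s =
      deriv K (ψ n s) * (s 1 ^ α₁ * partialDeriv 0 φ s) +
        φ s * deriv (deriv K) (ψ n s) * degX α₁ (ψ n) s := by
    intro n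
    filter_upwards [(hv n).degX_ae_eq α₁, (hψ n).degX_ae_eq α₁] with s h1 h2
    rw [h1, h2, hpd]
    ring
  have hWY : ∀ n, ∀ᵐ s ∂squareMeasure, degY α₂ (fun s => deriv K (ψ n s) * φ s) s =
      deriv K (ψ n s) * (s 0 ^ α₂ * partialDeriv 1 φ s) +
        φ s * deriv (deriv K) (ψ n s) * degY α₂ (ψ n) s := by
    intro n
    filter_upwards [(hv n).degY_ae_eq α₂, (hψ n).degY_ae_eq α₂] with s h1 h2
    rw [h1, h2, hpd]
    ring
  obtain ⟨e₁, he₁, hle₁⟩ := exists_error_le_integral_mul hu2.memLp_degX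
    (fun n => ((hψ n).memH1 α₁ α₂).memLp_degX) ((hφ.rpow_mul_partialDeriv α₁ 0 1).memLp 2)
    hφ.contDiff.continuous.aestronglyMeasurable hφ0 (fun s => (le_abs_self _).trans (hB s)) tX hkm
    (fun n s => hK1 _) (fun n s => hK2 (ψ n s)) (fun n s => hKC _) (fun n => (hvH n).memLp_degX)
    hWX
  obtain ⟨e₂, he₂, hle₂⟩ := exists_error_le_integral_mul hu2.memLp_degY
    (fun n => ((hψ n).memH1 α₁ α₂).memLp_degY) ((hφ.rpow_mul_partialDeriv α₂ 1 0).memLp 2)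
    hφ.contDiff.continuous.aestronglyMeasurable hφ0 (fun s => (le_abs_self _).trans (hB s)) tY hkm
    (fun n s => hK1 _) (fun n s => hK2 (ψ n s)) (fun n s => hKC _) (fun n => (hvH n).memLp_degY)
    hWY
  -- The potential term: `V |u| ≤ V (1 + u²)` is integrable and dominates.
  have hVu : Integrable (fun s => V s * u s) squareMeasure := by
    refine (hV.add hu.1.2).mono' (hV.1.mul hu2.memLp.1) ?_
    filter_upwards [hV0] with s hs
    rw [norm_mul, Real.norm_of_nonneg hs, Real.norm_eq_abs, Pi.add_apply, ← mul_one_add]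
    refine mul_le_mul_of_nonneg_left ?_ hs
    nlinarith [sq_abs (u s), sq_nonneg (|u s| - 1), abs_nonneg (u s)]
  have hvb : ∀ n s, |deriv K (ψ n s) * φ s| ≤ B := fun n s => by
    rw [abs_mul]
    exact (mul_le_of_le_one_left (abs_nonneg _) (hK1 _)).trans (hB s)
  have hVv : ∀ n, Integrable (fun s => V s * u s * (deriv K (ψ n s) * φ s)) squareMeasure :=
    fun n => hVu.mul_bdd (c := B) (hv n).contDiff.continuous.aestronglyMeasurable
      (.of_forall (hvb n))
  have hQ : Tendsto (fun n => ∫ s, V s * u s * (deriv K (ψ n s) * φ s) ∂squareMeasure) atTop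
      (𝓝 (∫ s, V s * u s * (deriv K (u s) * φ s) ∂squareMeasure)) := by
    refine tendsto_integral_of_dominated_convergence (fun s => ‖V s * u s‖ * B)
      (fun n => (hVv n).1) (hVu.norm.mul_const B) (fun n => .of_forall fun s => ?_) ?_
    · rw [norm_mul]
      exact mul_le_mul_of_nonneg_left (hvb n s) (norm_nonneg _)
    · filter_upwards [tae] with s hs
      exact (((hK'.continuous.tendsto _).comp hs).mul_const _).const_mul _
  have hQ0 : 0 ≤ ∫ s, V s * u s * (deriv K (u s) * φ s) ∂squareMeasure := by
    refine integral_nonneg_of_ae ?_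
    filter_upwards [hV0] with s hs
    have := mul_nonneg (mul_nonneg hs (hKt (u s))) (hφ0 s)
    simp only [Pi.zero_apply]
    linarith
  -- The main term, after integration by parts.
  have hKLip : ∀ a b, |K a - K b| ≤ |a - b| := fun a b => by
    have := Convex.norm_image_sub_le_of_norm_deriv_le (f := K) (C := 1) (s := univ) (x := b)
      (y := a) (fun t _ => hK.differentiable (by simp) t) (fun t _ => hK1 t) convex_univ
      (mem_univ _) (mem_univ _)
    simpa using this
  have hL2 := hφ.memLp_principalPart α₁ α₂ 2
  have hKψ : ∀ n, MemLp (fun s => K (ψ n s)) 2 squareMeasure :=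
    fun n => ((hψ n).comp_left hK hK0).memLp 2
  have hKu : MemLp (fun s => K (u s)) 2 squareMeasure :=
    hu2.memLp.mono (hK.continuous.comp_aestronglyMeasurable hu2.memLp.1) (.of_forall fun s => by
      simpa [hK0] using hKLip (u s) 0)
  have hmain : Tendsto (fun n => ∫ s, K (ψ n s) * principalPart α₁ α₂ φ s ∂squareMeasure) atTop
      (𝓝 (∫ s, K (u s) * principalPart α₁ α₂ φ s ∂squareMeasure)) := by
    rw [tendsto_iff_norm_sub_tendsto_zero, ← tendsto_zero_iff_norm_tendsto_zero]
    have := tendsto_integral_zero_of_abs_le_sub_mul hu2.memLp (fun n => (hψ n).memLp 2) hL2 t0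
      (H := fun n s => K (ψ n s) * principalPart α₁ α₂ φ s - K (u s) * principalPart α₁ α₂ φ s)
      fun n => .of_forall fun s => by
        rw [← sub_mul, abs_mul]
        exact mul_le_mul_of_nonneg_right (hKLip _ _) (abs_nonneg _)
    refine this.congr fun n => ?_
    exact integral_sub ((hKψ n).integrable_mul hL2) (hKu.integrable_mul hL2)
  have hparts : ∀ n, ∫ s, degX α₁ (ψ n) s * (deriv K (ψ n s) * (s 1 ^ α₁ * partialDeriv 0 φ s))
        ∂squareMeasure +
      ∫ s, degY α₂ (ψ n) s * (deriv K (ψ n s) * (s 0 ^ α₂ * partialDeriv 1 φ s)) ∂squareMeasure =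
      -∫ s, K (ψ n s) * principalPart α₁ α₂ φ s ∂squareMeasure := by
    intro n
    have h1 := integral_deg_mul_eq hφ (hψ n) hK hK0 (i := 0) (j := 1) (by decide) α₁
    have h2 := integral_deg_mul_eq hφ (hψ n) hK hK0 (i := 1) (j := 0) (by decide) α₂
    have h3 := integral_add
      ((hKψ n).integrable_mul ((hφ.rpow_mul_partialDeriv_partialDeriv (2 * α₁) 0 1).memLp 2))
      ((hKψ n).integrable_mul ((hφ.rpow_mul_partialDeriv_partialDeriv (2 * α₂) 1 0).memLp 2))
    have g1 : ∫ s, degX α₁ (ψ n) s * (deriv K (ψ n s) * (s 1 ^ α₁ * partialDeriv 0 φ s))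
        ∂squareMeasure = _ := (integral_congr_ae (by
      filter_upwards [(hψ n).degX_ae_eq α₁] with s hs
      rw [hs])).trans h1
    have g2 : ∫ s, degY α₂ (ψ n) s * (deriv K (ψ n s) * (s 0 ^ α₂ * partialDeriv 1 φ s))
        ∂squareMeasure = _ := (integral_congr_ae (by
      filter_upwards [(hψ n).degY_ae_eq α₂] with s hs
      rw [hs])).trans h2
    rw [g1, g2, ← neg_add]
    congr 1
    refine Eq.trans h3.symm (integral_congr_ae (.of_forall fun s => ?_))
    simp only [principalPart, Pi.mul_apply]
    ring
  have hkey : ∀ n, -∫ s, K (ψ n s) * principalPart α₁ α₂ φ s ∂squareMeasure - e₁ n - e₂ n +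
      ∫ s, V s * u s * (deriv K (ψ n s) * φ s) ∂squareMeasure ≤
      ∫ s, |f s| * φ s ∂squareMeasure := by
    intro n
    have hw := hu.2 _ ((hv n).memHZero α₁ α₂ hV)
    have iX := hu2.memLp_degX.integrable_mul (hvH n).memLp_degX
    have iY := hu2.memLp_degY.integrable_mul (hvH n).memLp_degY
    rw [bilinForm] at hw
    have hadd : ∫ s, (degX α₁ u s * degX α₁ (fun s => deriv K (ψ n s) * φ s) s +
          degY α₂ u s * degY α₂ (fun s => deriv K (ψ n s) * φ s) s +
          V s * u s * (deriv K (ψ n s) * φ s)) ∂squareMeasure =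
        ∫ s, degX α₁ u s * degX α₁ (fun s => deriv K (ψ n s) * φ s) s ∂squareMeasure +
        ∫ s, degY α₂ u s * degY α₂ (fun s => deriv K (ψ n s) * φ s) s ∂squareMeasure +
        ∫ s, V s * u s * (deriv K (ψ n s) * φ s) ∂squareMeasure :=
      (integral_add (iX.add iY) (hVv n)).trans (congrArg (· + _) (integral_add iX iY))
    have hfv : ∫ s, f s * (deriv K (ψ n s) * φ s) ∂squareMeasure ≤
        ∫ s, |f s| * φ s ∂squareMeasure := by
      refine integral_mono (hf.integrable_mul ((hv n).memLp 2))
        (hf.abs.integrable_mul (hφ.memLp 2)) fun s => ?_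
      refine (le_abs_self _).trans ?_
      beta_reduce
      rw [abs_mul, abs_mul, abs_of_nonneg (hφ0 s)]
      exact mul_le_mul_of_nonneg_left (mul_le_of_le_one_left (hφ0 s) (hK1 _)) (abs_nonneg _)
    have := hparts n
    have := hle₁ n
    have := hle₂ n
    linarith
  have := le_of_tendsto' (((hmain.neg.sub he₁).sub he₂).add hQ) hkey
  linarith

/-- The convex function `√(t² + δ²) - δ`, a smooth approximation of `|t|`. -/
noncomputable def smoothAbs (δ t : ℝ) : ℝ := √(t ^ 2 + δ ^ 2) - δ

theorem contDiff_smoothAbs {δ : ℝ} (hδ : 0 < δ) : ContDiff ℝ ∞ (smoothAbs δ) :=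
  (((contDiff_id.pow 2).add contDiff_const).sqrt fun t => by
    simp only [id]; positivity).sub contDiff_const

theorem deriv_smoothAbs {δ : ℝ} (hδ : 0 < δ) :
    deriv (smoothAbs δ) = fun t => t / √(t ^ 2 + δ ^ 2) := by
  ext t
  have h : HasDerivAt (fun t : ℝ => t ^ 2 + δ ^ 2) (2 * t) t := by
    simpa using (hasDerivAt_pow 2 t).add_const (δ ^ 2)
  have := ((h.sqrt (by positivity)).sub_const δ).deriv
  rw [show smoothAbs δ = fun t => √(t ^ 2 + δ ^ 2) - δ from rfl, this]
  exact mul_div_mul_left _ _ two_ne_zero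

theorem deriv_deriv_smoothAbs {δ : ℝ} (hδ : 0 < δ) (t : ℝ) :
    deriv (deriv (smoothAbs δ)) t = δ ^ 2 / √(t ^ 2 + δ ^ 2) ^ 3 := by
  have h : HasDerivAt (fun t : ℝ => t ^ 2 + δ ^ 2) (2 * t) t := by
    simpa using (hasDerivAt_pow 2 t).add_const (δ ^ 2)
  have hp : 0 < √(t ^ 2 + δ ^ 2) := by positivity
  have := ((hasDerivAt_id t).div (h.sqrt (by positivity)) hp.ne').deriv
  rw [deriv_smoothAbs hδ]
  refine this.trans ?_
  have hs : √(t ^ 2 + δ ^ 2) ^ 2 = t ^ 2 + δ ^ 2 := Real.sq_sqrt (by positivity)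
  simp only [id]
  field_simp
  rw [hs]
  ring

theorem abs_le_sqrt_sq_add_sq (t δ : ℝ) : |t| ≤ √(t ^ 2 + δ ^ 2) :=
  Real.abs_le_sqrt (by nlinarith [sq_nonneg δ])

/-- Kato's inequality: `-(y ^ (2 α₁) ∂ₓ² + x ^ (2 α₂) ∂_y²) |u| ≤ |f|` in the sense of
distributions. The potential has disappeared because it is nonnegative. -/
theorem IsWeakSolution.integral_abs_le {α₁ α₂ : ℝ} {V f u : Plane → ℝ}
    (hV : Integrable V squareMeasure) (hV0 : ∀ᵐ s ∂squareMeasure, 0 ≤ V s)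
    (hf : MemLp f 2 squareMeasure) (hu : IsWeakSolution α₁ α₂ V f u) {φ : Plane → ℝ}
    (hφ : IsTestFunction φ) (hφ0 : ∀ s, 0 ≤ φ s) :
    -∫ s, |u s| * principalPart α₁ α₂ φ s ∂squareMeasure ≤
      ∫ s, |f s| * φ s ∂squareMeasure := by
  have hL2 := hφ.memLp_principalPart α₁ α₂ 2
  have hL1 : Integrable (principalPart α₁ α₂ φ) squareMeasure :=
    memLp_one_iff_integrable.1 (hφ.memLp_principalPart α₁ α₂ 1)
  have hu2 := hu.1.1.1.memLp
  have hδ : ∀ δ : ℝ, 0 < δ → -∫ s, |u s| * principalPart α₁ α₂ φ s ∂squareMeasure ≤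
      ∫ s, |f s| * φ s ∂squareMeasure +
        δ * ∫ s, |principalPart α₁ α₂ φ s| ∂squareMeasure := by
    intro δ hδ
    have hle : ∀ t, δ ≤ √(t ^ 2 + δ ^ 2) := fun t => by
      rw [add_comm]; exact (le_abs_self δ).trans (abs_le_sqrt_sq_add_sq δ t)
    have hpos : ∀ t, 0 < √(t ^ 2 + δ ^ 2) := fun t => hδ.trans_le (hle t)
    have hupper : ∀ t, √(t ^ 2 + δ ^ 2) ≤ |t| + δ := fun t => Real.sqrt_le_iff.2
      ⟨by positivity, by nlinarith [sq_abs t, mul_nonneg (abs_nonneg t) hδ.le]⟩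
    have hclose : ∀ t, |smoothAbs δ t - (|t|)| ≤ δ := fun t => by
      have h1 := abs_le_sqrt_sq_add_sq t δ
      have h2 := hupper t
      rw [smoothAbs, abs_le]
      constructor <;> linarith
    have hsm : MemLp (fun s => smoothAbs δ (u s)) 2 squareMeasure := by
      refine hu2.mono
        ((contDiff_smoothAbs hδ).continuous.comp_aestronglyMeasurable hu2.1)
        (.of_forall fun s => ?_)
      rw [Real.norm_eq_abs, Real.norm_eq_abs, smoothAbs, abs_of_nonneg (by linarith [hle (u s)])]
      linarith [hupper (u s)]
    have hreg := hu.integral_convex_comp_le (C := δ ^ 2 / δ ^ 3) hV hV0 hf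
      (contDiff_smoothAbs hδ) (by rw [smoothAbs]; simp [Real.sqrt_sq hδ.le])
      (fun t => by
        rw [deriv_smoothAbs hδ, abs_div, abs_of_pos (hpos t), div_le_one (hpos t)]
        exact abs_le_sqrt_sq_add_sq t δ)
      (fun t => by
        rw [deriv_smoothAbs hδ]
        have := hpos t
        rw [← mul_div_assoc, ← sq]
        positivity)
      (fun t => by
        rw [deriv_deriv_smoothAbs hδ]
        positivity)
      (fun t => by
        rw [deriv_deriv_smoothAbs hδ]
        exact div_le_div_of_nonneg_left (by positivity) (by positivity)
          (pow_le_pow_left₀ hδ.le (hle t) 3))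
      hφ hφ0
    have hdiff : ∫ s, smoothAbs δ (u s) * principalPart α₁ α₂ φ s ∂squareMeasure -
        ∫ s, |u s| * principalPart α₁ α₂ φ s ∂squareMeasure ≤
        δ * ∫ s, |principalPart α₁ α₂ φ s| ∂squareMeasure := by
      rw [← integral_const_mul]
      refine (integral_sub (hsm.integrable_mul hL2) (hu2.abs.integrable_mul hL2)).symm.le.trans
        (integral_mono ((hsm.integrable_mul hL2).sub (hu2.abs.integrable_mul hL2))
          (hL1.abs.const_mul δ) fun s => ?_)
      simp only [Pi.mul_apply]
      rw [← sub_mul]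
      refine (le_abs_self _).trans ?_
      rw [abs_mul]
      exact mul_le_mul_of_nonneg_right (hclose _) (abs_nonneg _)
    linarith
  set I := ∫ s, |principalPart α₁ α₂ φ s| ∂squareMeasure with hI
  have hI0 : 0 ≤ I := integral_nonneg fun s => abs_nonneg _
  refine le_of_forall_pos_le_add fun ε hε => (hδ (ε / (I + 1)) (by positivity)).trans ?_
  gcongr
  rw [div_mul_eq_mul_div, div_le_iff₀ (by positivity)]
  nlinarith

/-! ### The profile of the barrier -/

/-- The profile `ψ(q) (2 - ½ log q - (2 / r) √q)`, where the smooth cutoff `ψ` is `1` for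
`q ≤ r² / 2` and `0` for `q ≥ r²`. With `q` the square of a distance, `-½ log q` is the
fundamental solution of the Laplacian, and the term in `√q` absorbs the error made by freezing the
coefficients. -/
noncomputable def profile (r q : ℝ) : ℝ :=
  Real.smoothTransition (2 - 2 * q / r ^ 2) * (2 - Real.log q / 2 - 2 / r * √q)

theorem contDiffAt_profile {r q : ℝ} (hq : 0 < q) : ContDiffAt ℝ ∞ (profile r) q := by
  have h1 : ContDiffAt ℝ ∞ (fun q : ℝ => Real.smoothTransition (2 - 2 * q / r ^ 2)) q :=
    (Real.smoothTransition.contDiff.comp (contDiff_const.sub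
      ((contDiff_const.mul contDiff_id).div_const _))).contDiffAt
  exact h1.mul ((contDiffAt_const.sub ((Real.contDiffAt_log.2 hq.ne').div_const _)).sub
    (contDiffAt_const.mul (Real.contDiffAt_sqrt hq.ne')))

theorem contDiffAt_deriv_profile {r q : ℝ} (hq : 0 < q) :
    ContDiffAt ℝ ∞ (deriv (profile r)) q :=
  (((contDiffOn_infty_iff_deriv_of_isOpen isOpen_Ioi).1 fun _ hx =>
    (contDiffAt_profile (r := r) hx).contDiffWithinAt).2).contDiffAt (Ioi_mem_nhds hq)

theorem profile_eq_zero {r q : ℝ} (hr : 0 < r) (hq : r ^ 2 ≤ q) : profile r q = 0 := by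
  rw [profile, Real.smoothTransition.zero_of_nonpos, zero_mul]
  have : 2 ≤ 2 * q / r ^ 2 := by rw [le_div_iff₀ (by positivity)]; linarith
  linarith

theorem deriv_profile_eq_zero {r q : ℝ} (hr : 0 < r) (hq : r ^ 2 < q) :
    deriv (profile r) q = 0 := by
  have : profile r =ᶠ[𝓝 q] fun _ => 0 := by
    filter_upwards [Ioi_mem_nhds hq] with x hx using profile_eq_zero hr (le_of_lt hx)
  rw [this.deriv_eq, deriv_const]

theorem deriv_deriv_profile_eq_zero {r q : ℝ} (hr : 0 < r) (hq : r ^ 2 < q) :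
    deriv (deriv (profile r)) q = 0 := by
  have : deriv (profile r) =ᶠ[𝓝 q] fun _ => 0 := by
    filter_upwards [Ioi_mem_nhds hq] with x hx using deriv_profile_eq_zero hr hx
  rw [this.deriv_eq, deriv_const]

theorem profile_eq {r q : ℝ} (hr : 0 < r) (hq : q ≤ r ^ 2 / 2) :
    profile r q = 2 - Real.log q / 2 - 2 / r * √q := by
  rw [profile, Real.smoothTransition.one_of_one_le, one_mul]
  have : 2 * q / r ^ 2 ≤ 1 := by rw [div_le_one (by positivity)]; linarith
  linarith

theorem deriv_profile {r q : ℝ} (hr : 0 < r) (hq0 : 0 < q) (hq : q < r ^ 2 / 2) :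
    deriv (profile r) q = -(2 * q)⁻¹ - r⁻¹ * (√q)⁻¹ := by
  have : profile r =ᶠ[𝓝 q] fun q => 2 - Real.log q / 2 - 2 / r * √q := by
    filter_upwards [Iio_mem_nhds hq] with x hx using profile_eq hr (le_of_lt hx)
  have h := (((Real.hasDerivAt_log hq0.ne').div_const 2).const_sub 2).sub
    ((Real.hasDerivAt_sqrt hq0.ne').const_mul (2 / r))
  rw [this.deriv_eq]
  refine h.deriv.trans ?_
  have : 0 < √q := by positivity
  field_simp

theorem deriv_deriv_profile {r q : ℝ} (hr : 0 < r) (hq0 : 0 < q) (hq : q < r ^ 2 / 2) :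
    deriv (deriv (profile r)) q = (2 * q ^ 2)⁻¹ + (2 * r)⁻¹ * (√q ^ 3)⁻¹ := by
  have : deriv (profile r) =ᶠ[𝓝 q] fun q => -(2 * q)⁻¹ - r⁻¹ * (√q)⁻¹ := by
    filter_upwards [Iio_mem_nhds hq, Ioi_mem_nhds hq0] with x hx hx0 using deriv_profile hr hx0 hx
  have hs : 0 < √q := by positivity
  have h2 : HasDerivAt (fun q : ℝ => 2 * q) 2 q := by simpa using (hasDerivAt_id q).const_mul 2
  have h := ((h2.fun_inv (by positivity)).fun_neg).fun_sub
    (((Real.hasDerivAt_sqrt hq0.ne').fun_inv hs.ne').const_mul r⁻¹)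
  rw [this.deriv_eq]
  refine h.deriv.trans ?_
  field_simp
  ring

theorem log_nonpos_of_lt_sq {r q : ℝ} (hr1 : r ≤ 1) (hr : 0 < r) (hq0 : 0 < q) (hq : q < r ^ 2) :
    Real.log q ≤ 0 :=
  Real.log_nonpos hq0.le (hq.le.trans (pow_le_one₀ hr.le hr1))

theorem profile_nonneg {r q : ℝ} (hr : 0 < r) (hr1 : r ≤ 1) (hq0 : 0 < q) :
    0 ≤ profile r q := by
  rcases le_or_gt (r ^ 2) q with hq | hq
  · rw [profile_eq_zero hr hq]
  refine mul_nonneg (Real.smoothTransition.nonneg _) ?_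
  have h1 := log_nonpos_of_lt_sq hr1 hr hq0 hq
  have h2 : √q ≤ r := (Real.sqrt_le_left hr.le).2 hq.le
  have h3 : 2 / r * √q ≤ 2 := by
    rw [div_mul_eq_mul_div, div_le_iff₀ hr]; linarith
  linarith

/-- The profile is `O(q ^ (-1/4))`, hence square integrable as a function on the plane, uniformly
in the position of its pole. -/
theorem sq_profile_le {r q : ℝ} (hr : 0 < r) (hr1 : r ≤ 1) (hq0 : 0 < q) :
    profile r q ^ 2 ≤ 4 / √q := by
  have hs : 0 < √q := by positivity
  rcases le_or_gt (r ^ 2) q with hq | hq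
  · rw [profile_eq_zero hr hq, zero_pow two_ne_zero]; positivity
  have hss : 0 < √√q := by positivity
  have hle : profile r q ≤ 2 / √√q := by
    have h1 := log_nonpos_of_lt_sq hr1 hr hq0 hq
    have h2 : 0 ≤ 2 / r * √q := by positivity
    have h3 := Real.log_le_sub_one_of_pos (inv_pos.2 hss)
    rw [Real.log_inv, Real.log_sqrt hs.le, Real.log_sqrt hq0.le] at h3
    have h0 := profile_nonneg hr hr1 hq0
    rw [profile] at h0 ⊢
    have hψ0 := Real.smoothTransition.nonneg (2 - 2 * q / r ^ 2)
    have hψ1 := Real.smoothTransition.le_one (2 - 2 * q / r ^ 2)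
    have h4 := div_eq_mul_inv 2 (√√q)
    calc _ ≤ Real.smoothTransition (2 - 2 * q / r ^ 2) * (2 - Real.log q / 2) :=
          mul_le_mul_of_nonneg_left (by linarith) hψ0
      _ ≤ 1 * (2 - Real.log q / 2) := mul_le_mul_of_nonneg_right hψ1 (by linarith)
      _ ≤ _ := by linarith
  calc profile r q ^ 2 ≤ (2 / √√q) ^ 2 := pow_le_pow_left₀ (profile_nonneg hr hr1 hq0) hle 2
    _ = 4 / √q := by rw [div_pow, Real.sq_sqrt hs.le]; norm_num

theorem exists_bound_deriv_profile {r : ℝ} (hr : 0 < r) : ∃ B, 0 ≤ B ∧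
    ∀ q ∈ Icc (r ^ 2 / 2) (r ^ 2),
      |deriv (profile r) q| ≤ B ∧ |deriv (deriv (profile r)) q| ≤ B := by
  have hpos : ∀ q ∈ Icc (r ^ 2 / 2) (r ^ 2), 0 < q := fun q hq =>
    lt_of_lt_of_le (by positivity) hq.1
  have h1 : ContinuousOn (deriv (profile r)) (Icc (r ^ 2 / 2) (r ^ 2)) := fun q hq =>
    (contDiffAt_deriv_profile (hpos q hq)).continuousAt.continuousWithinAt
  have h2 : ContinuousOn (deriv (deriv (profile r))) (Icc (r ^ 2 / 2) (r ^ 2)) := fun q hq =>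
    ((((contDiffOn_infty_iff_deriv_of_isOpen isOpen_Ioi).1 fun x hx =>
      (contDiffAt_deriv_profile (r := r) hx).contDiffWithinAt).2).contDiffAt
        (Ioi_mem_nhds (hpos q hq))).continuousAt.continuousWithinAt
  obtain ⟨B₁, hB₁⟩ := isCompact_Icc.exists_bound_of_continuousOn h1
  obtain ⟨B₂, hB₂⟩ := isCompact_Icc.exists_bound_of_continuousOn h2
  exact ⟨max 0 (max B₁ B₂), le_max_left _ _, fun q hq =>
    ⟨(hB₁ q hq).trans ((le_max_left _ _).trans (le_max_right _ _)),
      (hB₂ q hq).trans ((le_max_right _ _).trans (le_max_right _ _))⟩⟩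

/-! ### The barrier -/

/-- The square of the distance to `z` in the metric with the frozen coefficients `c`,
regularised by `ε²`. -/
noncomputable def quad (c : Fin 2 → ℝ) (z : Plane) (ε : ℝ) (s : Plane) : ℝ :=
  (s 0 - z 0) ^ 2 / c 0 + (s 1 - z 1) ^ 2 / c 1 + ε ^ 2

theorem contDiff_quad (c : Fin 2 → ℝ) (z : Plane) (ε : ℝ) : ContDiff ℝ ∞ (quad c z ε) := by
  have h : ∀ i : Fin 2, ContDiff ℝ ∞ fun s : Plane => s i :=
    fun i => (EuclideanSpace.proj i : Plane →L[ℝ] ℝ).contDiff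
  exact (((((h 0).sub contDiff_const).pow 2).div_const _).add
    ((((h 1).sub contDiff_const).pow 2).div_const _)).add contDiff_const

theorem partialDeriv_quad (c : Fin 2 → ℝ) (z : Plane) (ε : ℝ) (i : Fin 2) (s : Plane) :
    partialDeriv i (quad c z ε) s = 2 * (s i - z i) / c i := by
  have hd : ∀ j : Fin 2, DifferentiableAt ℝ (fun t : Plane => t j) s := fun j => by fun_prop
  have hg : ∀ j : Fin 2, HasDerivAt (fun x : ℝ => (x - z j) ^ 2 / c j)
      (2 * (s j - z j) / c j) (s j) := fun j => by
    simpa using (((hasDerivAt_id (s j)).sub_const (z j)).pow 2).div_const (c j)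
  have h : ∀ j : Fin 2, HasFDerivAt ((fun x : ℝ => (x - z j) ^ 2 / c j) ∘ fun t : Plane => t j)
      ((2 * (s j - z j) / c j) • fderiv ℝ (fun t : Plane => t j) s) s := fun j =>
    (hg j).comp_hasFDerivAt s (hd j).hasFDerivAt
  have hq := (((h 0).add (h 1)).add_const (ε ^ 2)).fderiv
  have h0 := partialDeriv_coord i 0 s
  have h1 := partialDeriv_coord i 1 s
  simp only [partialDeriv] at h0 h1 ⊢
  refine (congrArg (fun l : Plane →L[ℝ] ℝ => l (EuclideanSpace.single i 1)) hq).trans ?_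
  simp only [add_apply, smul_apply, h0, h1, smul_eq_mul]
  fin_cases i <;> simp

theorem quad_pos {c : Fin 2 → ℝ} (hc : ∀ i, 0 < c i) (z : Plane) {ε : ℝ} (hε : 0 < ε)
    (s : Plane) : 0 < quad c z ε s := by
  have := hc 0
  have := hc 1
  unfold quad
  positivity

theorem norm_sub_sq (s z : Plane) : ‖s - z‖ ^ 2 = (s 0 - z 0) ^ 2 + (s 1 - z 1) ^ 2 := by
  rw [EuclideanSpace.norm_sq_eq]
  simp [Fin.sum_univ_two]

theorem norm_sub_sq_le_quad {c : Fin 2 → ℝ} (hc : ∀ i, 0 < c i) (hc1 : ∀ i, c i ≤ 1)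
    (z : Plane) (ε : ℝ) (s : Plane) : ‖s - z‖ ^ 2 ≤ quad c z ε s := by
  have h : ∀ i, (s i - z i) ^ 2 ≤ (s i - z i) ^ 2 / c i := fun i =>
    le_div_self (sq_nonneg _) (hc i) (hc1 i)
  rw [norm_sub_sq, quad]
  nlinarith [h 0, h 1, sq_nonneg ε]

theorem quad_le {c : Fin 2 → ℝ} {m : ℝ} (hm : 0 < m) (hc : ∀ i, m ≤ c i) (z : Plane) (ε : ℝ)
    (s : Plane) : quad c z ε s ≤ ‖s - z‖ ^ 2 / m + ε ^ 2 := by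
  have h : ∀ i, (s i - z i) ^ 2 / c i ≤ (s i - z i) ^ 2 / m := fun i =>
    div_le_div_of_nonneg_left (sq_nonneg _) hm (hc i)
  rw [norm_sub_sq, quad, add_div]
  linarith [h 0, h 1]

theorem partialDeriv_partialDeriv_profile_quad {c : Fin 2 → ℝ} (hc : ∀ i, 0 < c i) (r : ℝ)
    (z : Plane) {ε : ℝ} (hε : 0 < ε) (i : Fin 2) (s : Plane) :
    partialDeriv i (partialDeriv i fun t => profile r (quad c z ε t)) s =
      (4 * deriv (deriv (profile r)) (quad c z ε s) * ((s i - z i) ^ 2 / c i) +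
        2 * deriv (profile r) (quad c z ε s)) / c i := by
  have hQ : Differentiable ℝ (quad c z ε) := (contDiff_quad c z ε).differentiable (by simp)
  have h1 : (partialDeriv i fun t => profile r (quad c z ε t)) = fun t =>
      deriv (profile r) (quad c z ε t) * partialDeriv i (quad c z ε) t := by
    ext t
    exact partialDeriv_comp i
      ((contDiffAt_profile (quad_pos hc z hε t)).differentiableAt (by simp)) (hQ t)
  have h2 : partialDeriv i (partialDeriv i (quad c z ε)) s = 2 / c i := by
    have hd : DifferentiableAt ℝ (fun t : Plane => t i) s := by fun_prop
    have e : partialDeriv i (quad c z ε) = fun t => (fun x => 2 * (x - z i) / c i) (t i) := by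
      ext t
      exact partialDeriv_quad c z ε i t
    have hg : HasDerivAt (fun x : ℝ => 2 * (x - z i) / c i) (2 / c i) (s i) := by
      simpa using (((hasDerivAt_id (s i)).sub_const (z i)).const_mul 2).div_const (c i)
    rw [e, partialDeriv_comp i hg.differentiableAt hd, hg.deriv, partialDeriv_coord]
    simp
  have hd1 : DifferentiableAt ℝ (deriv (profile r)) (quad c z ε s) :=
    (contDiffAt_deriv_profile (quad_pos hc z hε s)).differentiableAt (by simp)
  have hd2 : DifferentiableAt ℝ (partialDeriv i (quad c z ε)) s := by
    have : ContDiff ℝ ∞ (partialDeriv i (quad c z ε)) :=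
      ((contDiff_quad c z ε).fderiv_right (m := ∞) (by simp)).clm_apply contDiff_const
    exact this.differentiable (by simp) s
  rw [h1, partialDeriv_mul (φ := fun t => deriv (profile r) (quad c z ε t)) i
    (hd1.comp s (hQ s)) hd2, partialDeriv_comp i hd1 (hQ s), h2,
    partialDeriv_quad]
  have := (hc i).ne'
  field_simp
  ring

/-- The computation at the heart of the barrier: in the metric of the frozen coefficients,
`x + y + e` is the regularised squared distance `t²`, and the true coefficients are `1 + d₁` and
`1 + d₂`. The term of the profile in `√q` outweighs the contribution of `d₁` and `d₂`. -/
theorem barrier_inequality {r t x y e d₁ d₂ : ℝ} (hr : 0 < r) (ht : 0 < t) (htr : t ≤ r)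
    (hx : 0 ≤ x) (hy : 0 ≤ y) (he : 0 ≤ e) (hsum : x + y + e = t ^ 2)
    (hd₁ : |d₁| ≤ t / (3 * r)) (hd₂ : |d₂| ≤ t / (3 * r)) :
    (1 + d₁) * (4 * ((2 * (t ^ 2) ^ 2)⁻¹ + (2 * r)⁻¹ * (t ^ 3)⁻¹) * x +
        2 * (-(2 * t ^ 2)⁻¹ - r⁻¹ * t⁻¹)) +
      (1 + d₂) * (4 * ((2 * (t ^ 2) ^ 2)⁻¹ + (2 * r)⁻¹ * (t ^ 3)⁻¹) * y +
        2 * (-(2 * t ^ 2)⁻¹ - r⁻¹ * t⁻¹)) ≤ -(2 * e / (t ^ 2) ^ 2) := by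
  have hb : ∀ d w : ℝ, |d| ≤ t / (3 * r) → 0 ≤ w → w ≤ t ^ 2 →
      d * (r * (2 * w - t ^ 2) + 2 * t * (w - t ^ 2)) ≤ t ^ 3 := by
    intro d w hd hw0 hw
    have h1 : |d| * (3 * r) ≤ t := by rwa [le_div_iff₀ (by positivity)] at hd
    have h2 : |r * (2 * w - t ^ 2) + 2 * t * (w - t ^ 2)| ≤ 3 * r * t ^ 2 := by
      have hrt : 0 ≤ (r - t) * (t ^ 2 - w) := mul_nonneg (by linarith) (by linarith)
      have hrw : 0 ≤ r * w := by positivity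
      have htw : 0 ≤ t * (t ^ 2 - w) := mul_nonneg ht.le (by linarith)
      have hrw' : 0 ≤ r * (t ^ 2 - w) := mul_nonneg hr.le (by linarith)
      rw [abs_le]
      constructor <;> nlinarith
    calc _ ≤ |d * (r * (2 * w - t ^ 2) + 2 * t * (w - t ^ 2))| := le_abs_self _
      _ ≤ |d| * (3 * r * t ^ 2) := by
        rw [abs_mul]; exact mul_le_mul_of_nonneg_left h2 (abs_nonneg _)
      _ = |d| * (3 * r) * t ^ 2 := by ring
      _ ≤ t * t ^ 2 := mul_le_mul_of_nonneg_right h1 (by positivity)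
      _ = t ^ 3 := by ring
  have hb₁ := hb d₁ x hd₁ hx (by linarith)
  have hb₂ := hb d₂ y hd₂ hy (by linarith)
  have hte : 0 ≤ t * e := by positivity
  have hfac : (1 + d₁) * (4 * ((2 * (t ^ 2) ^ 2)⁻¹ + (2 * r)⁻¹ * (t ^ 3)⁻¹) * x +
        2 * (-(2 * t ^ 2)⁻¹ - r⁻¹ * t⁻¹)) +
      (1 + d₂) * (4 * ((2 * (t ^ 2) ^ 2)⁻¹ + (2 * r)⁻¹ * (t ^ 3)⁻¹) * y +
        2 * (-(2 * t ^ 2)⁻¹ - r⁻¹ * t⁻¹)) =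
      ((1 + d₁) * (r * (2 * x - t ^ 2) + 2 * t * (x - t ^ 2)) +
        (1 + d₂) * (r * (2 * y - t ^ 2) + 2 * t * (y - t ^ 2))) / (r * t ^ 4) := by
    field_simp
    ring
  have hrhs : -(2 * e / (t ^ 2) ^ 2) = -(2 * r * e) / (r * t ^ 4) := by
    field_simp
  rw [hfac, hrhs]
  refine div_le_div_of_nonneg_right ?_ (by positivity)
  have hx' : x = t ^ 2 - y - e := by linarith
  have hid : r * (2 * x - t ^ 2) + 2 * t * (x - t ^ 2) + (r * (2 * y - t ^ 2) +
      2 * t * (y - t ^ 2)) = -(2 * r * e) - 2 * (t * e) - 2 * t ^ 3 := by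
    rw [hx']; ring
  linarith

theorem abs_rpow_sub_one_le {t β : ℝ} (ht : 0 < t) (hβ0 : 0 ≤ β) (hβ1 : β ≤ 1) :
    |t ^ β - 1| ≤ |t - 1| := by
  rcases le_total 1 t with h | h
  · have h1 := Real.one_le_rpow h hβ0
    have h2 : t ^ β ≤ t ^ (1 : ℝ) := Real.rpow_le_rpow_of_exponent_le h hβ1
    rw [Real.rpow_one] at h2
    rw [abs_of_nonneg (by linarith), abs_of_nonneg (by linarith)]
    linarith
  · have h1 := Real.rpow_le_one ht.le h hβ0
    have h2 : t ^ (1 : ℝ) ≤ t ^ β := Real.rpow_le_rpow_of_exponent_ge ht h hβ1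
    rw [Real.rpow_one] at h2
    rw [abs_of_nonpos (by linarith), abs_of_nonpos (by linarith)]
    linarith

/-- The relative oscillation of the coefficient `x ^ β` on an interval away from `0`. -/
theorem abs_rpow_div_rpow_sub_one_le {x y β m : ℝ} (hx : 0 < x) (hm : 0 < m) (hy : m ≤ y)
    (hβ0 : 0 ≤ β) (hβ1 : β ≤ 1) : |x ^ β / y ^ β - 1| ≤ |x - y| / m := by
  have hy0 : 0 < y := hm.trans_le hy
  rw [← Real.div_rpow hx.le hy0.le]
  refine (abs_rpow_sub_one_le (div_pos hx hy0) hβ0 hβ1).trans ?_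
  rw [div_sub_one hy0.ne', abs_div, abs_of_pos hy0]
  exact div_le_div_of_nonneg_left (abs_nonneg _) hm hy

theorem abs_coord_sub_le (s z : Plane) (i : Fin 2) : |s i - z i| ≤ ‖s - z‖ := by
  simpa using PiLp.norm_apply_le (s - z) i

/-- The barriers: around every pole `z` and at every small scale `ε` there is a nonnegative test
function, bounded by `2 ‖s - z‖ ^ (-1/2)`, on which minus the principal part dominates
`κ ε⁻²` on the ball of radius `ε` up to a bounded error, with constants independent of `z` and
`ε`. -/
theorem exists_barrier {α₁ α₂ r : ℝ} (hα₁ : 0 ≤ α₁ ∧ α₁ ≤ 1 / 2) (hα₂ : 0 ≤ α₂ ∧ α₂ ≤ 1 / 2)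
    (hr : 0 < r) (hr1 : r ≤ 1) : ∃ C κ ε₀ : ℝ, 0 ≤ C ∧ 0 < κ ∧ 0 < ε₀ ∧ ε₀ ≤ r ∧
      ∀ z : Plane, closedBall z r ⊆ unitSquare → (∀ i, 3 * r ≤ z i) → ∀ ε, 0 < ε → ε < ε₀ →
        ∃ φ, IsTestFunction φ ∧ (∀ s, 0 ≤ φ s) ∧ (∀ s, s ∉ ball z r → φ s = 0) ∧
          (∀ s, s ≠ z → φ s ^ 2 ≤ 4 / ‖s - z‖) ∧
          ∀ s ∈ unitSquare, principalPart α₁ α₂ φ s ≤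
            (closedBall z r).indicator (fun _ => C) s -
              (closedBall z ε).indicator (fun _ => κ / ε ^ 2) s := by
  obtain ⟨B, hB0, hB⟩ := exists_bound_deriv_profile hr
  set k : ℝ := 1 / (3 * r) + 1 with hk
  have hk1 : 1 ≤ k := le_add_of_nonneg_left (by positivity)
  have hk0 : 0 < k := by linarith
  refine ⟨16 * B, 2 / k ^ 2, r / (2 * k), by positivity, by positivity, by positivity,
    div_le_self hr.le (by linarith), fun z hz hz3 ε hε hεlt => ?_⟩
  -- On the ball of radius `ε` the regularised distance is at most `k ε²`, and there the profile
  -- must not be cut off.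
  have hkε : k * ε ^ 2 < r ^ 2 / 2 := by
    have h1 : ε * (2 * k) < r := by rwa [lt_div_iff₀ (by positivity)] at hεlt
    have h2 : (ε * (2 * k)) ^ 2 < r ^ 2 := pow_lt_pow_left₀ h1 (by positivity) two_ne_zero
    have h3 : k * ε ^ 2 ≤ k * (k * ε ^ 2) := le_mul_of_one_le_left (by positivity) hk1
    nlinarith
  have hzmem : z ∈ unitSquare := hz (mem_closedBall_self hr.le)
  have hz0 : ∀ i, 0 < z i := pos_of_mem_unitSquare hzmem
  have hz1 : ∀ i, z i ≤ 1 := fun i => (lt_one_of_mem_unitSquare hzmem i).le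
  have hrp : ∀ {β : ℝ} (i : Fin 2), 0 ≤ β → β ≤ 1 → 3 * r ≤ z i ^ β ∧ z i ^ β ≤ 1 := by
    intro β i h0 h1
    have h2 : z i ^ (1 : ℝ) ≤ z i ^ β := Real.rpow_le_rpow_of_exponent_ge (hz0 i) (hz1 i) h1
    rw [Real.rpow_one] at h2
    exact ⟨(hz3 i).trans h2, Real.rpow_le_one (hz0 i).le (hz1 i) h0⟩
  set c : Fin 2 → ℝ := ![z 1 ^ (2 * α₁), z 0 ^ (2 * α₂)] with hcdef
  have hc : ∀ i, 3 * r ≤ c i ∧ c i ≤ 1 := by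
    intro i
    fin_cases i
    · exact hrp 1 (by linarith) (by linarith)
    · exact hrp 0 (by linarith) (by linarith)
  have hc0 : ∀ i, 0 < c i := fun i => lt_of_lt_of_le (by positivity) (hc i).1
  have hq0 : ∀ s, 0 < quad c z ε s := quad_pos hc0 z hε
  have hqn : ∀ s, ‖s - z‖ ^ 2 ≤ quad c z ε s := norm_sub_sq_le_quad hc0 (fun i => (hc i).2) z ε
  have hfar : ∀ s, s ∉ ball z r → profile r (quad c z ε s) = 0 := by
    intro s hs
    rw [mem_ball, not_lt, dist_eq_norm] at hs
    exact profile_eq_zero hr ((pow_le_pow_left₀ hr.le hs 2).trans (hqn s))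
  have hts : tsupport (fun s => profile r (quad c z ε s)) ⊆ closedBall z r :=
    closure_minimal (fun s hs => ball_subset_closedBall (by
      by_contra h
      exact hs (hfar s h))) isClosed_closedBall
  refine ⟨fun s => profile r (quad c z ε s),
    ⟨contDiff_iff_contDiffAt.2 fun s => (contDiffAt_profile (hq0 s)).comp s
      (contDiff_quad c z ε).contDiffAt,
      HasCompactSupport.of_support_subset_isCompact (isCompact_closedBall z r)
        ((subset_tsupport _).trans hts), hts.trans hz⟩,
    fun s => profile_nonneg hr hr1 (hq0 s), hfar, fun s hs => ?_, fun s hs => ?_⟩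
  · refine (sq_profile_le hr hr1 (hq0 s)).trans ?_
    have h0 : 0 < ‖s - z‖ := norm_pos_iff.2 (sub_ne_zero.2 hs)
    exact div_le_div_of_nonneg_left (by norm_num) h0 (Real.le_sqrt_of_sq_le (hqn s))
  set q := quad c z ε s with hqdef
  set x := (s 0 - z 0) ^ 2 / c 0 with hx
  set y := (s 1 - z 1) ^ 2 / c 1 with hy
  have hqxy : x + y + ε ^ 2 = q := rfl
  have hx0 : 0 ≤ x := div_nonneg (sq_nonneg _) (hc0 0).le
  have hy0 : 0 ≤ y := div_nonneg (sq_nonneg _) (hc0 1).le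
  set d₁ := s 1 ^ (2 * α₁) / c 0 - 1 with hd₁
  set d₂ := s 0 ^ (2 * α₂) / c 1 - 1 with hd₂
  -- The coefficients move by at most the relative oscillation of their argument, with a Lipschitz
  -- constant that the smallest distance `3 r` to the axes controls.
  have hosc : ∀ {β : ℝ} (i : Fin 2), 0 ≤ β → β ≤ 1 →
      |s i ^ β / z i ^ β - 1| ≤ √q / (3 * r) := by
    intro β i h0 h1
    refine (abs_rpow_div_rpow_sub_one_le (pos_of_mem_unitSquare hs i) (by positivity) (hz3 i)
      h0 h1).trans (div_le_div_of_nonneg_right ?_ (by positivity))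
    exact (abs_coord_sub_le s z i).trans (Real.le_sqrt_of_sq_le (hqn s))
  have hb₁ : |d₁| ≤ √q / (3 * r) := hosc 1 (by linarith) (by linarith)
  have hb₂ : |d₂| ≤ √q / (3 * r) := hosc 0 (by linarith) (by linarith)
  have hprin : principalPart α₁ α₂ (fun s => profile r (quad c z ε s)) s =
      (1 + d₁) * (4 * deriv (deriv (profile r)) q * x + 2 * deriv (profile r) q) +
        (1 + d₂) * (4 * deriv (deriv (profile r)) q * y + 2 * deriv (profile r) q) := by
    rw [principalPart, partialDeriv_partialDeriv_profile_quad hc0 r z hε,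
      partialDeriv_partialDeriv_profile_quad hc0 r z hε, hd₁, hd₂]
    ring
  have hC0 : 0 ≤ (closedBall z r).indicator (fun _ => 16 * B) s :=
    indicator_nonneg (fun _ _ => by positivity) s
  have hsr : q ≤ r ^ 2 → s ∈ closedBall z r := fun h => by
    rw [mem_closedBall, dist_eq_norm]
    exact (pow_le_pow_iff_left₀ (norm_nonneg _) hr.le two_ne_zero).1 ((hqn s).trans h)
  have hsε : s ∈ closedBall z ε → q ≤ k * ε ^ 2 := fun h => by
    rw [mem_closedBall, dist_eq_norm] at h
    refine (quad_le (by positivity) (fun i => (hc i).1) z ε s).trans ?_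
    have := div_le_div_of_nonneg_right (pow_le_pow_left₀ (norm_nonneg _) h 2)
      (by positivity : 0 ≤ 3 * r)
    rw [hk, add_mul, one_mul, one_div_mul_eq_div]
    linarith
  rw [hprin]
  rcases lt_or_ge q (r ^ 2 / 2) with hlt | hge
  · -- Near the pole the profile is not cut off.
    have ht : 0 < √q := Real.sqrt_pos.2 (hq0 s)
    have htq : √q ^ 2 = q := Real.sq_sqrt (hq0 s).le
    have htr : √q ≤ r := (Real.sqrt_le_left hr.le).2 (by linarith [sq_nonneg r])
    have hmain := barrier_inequality hr ht htr hx0 hy0 (sq_nonneg ε) (hqxy.trans htq.symm)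
      hb₁ hb₂
    rw [htq] at hmain
    rw [deriv_deriv_profile hr (hq0 s) hlt, deriv_profile hr (hq0 s) hlt]
    refine hmain.trans ?_
    have hdom : (closedBall z ε).indicator (fun _ => 2 / k ^ 2 / ε ^ 2) s ≤
        2 * ε ^ 2 / q ^ 2 := by
      by_cases h : s ∈ closedBall z ε
      swap
      · rw [indicator_of_notMem h]
        positivity
      rw [indicator_of_mem h]
      have h1 : q ^ 2 ≤ (k * ε ^ 2) ^ 2 := pow_le_pow_left₀ (hq0 s).le (hsε h) 2
      have h2 : 2 / k ^ 2 / ε ^ 2 = 2 * ε ^ 2 / (k * ε ^ 2) ^ 2 := by field_simp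
      rw [h2]
      exact div_le_div_of_nonneg_left (by positivity) (pow_pos (hq0 s) 2) h1
    linarith
  have hnot : s ∉ closedBall z ε := fun h => by linarith [hsε h]
  rw [indicator_of_notMem hnot, sub_zero]
  rcases le_or_gt q (r ^ 2) with hle | hgt
  · -- In the transition layer everything is bounded.
    rw [indicator_of_mem (hsr hle)]
    obtain ⟨h1, h2⟩ := hB q ⟨hge, hle⟩
    have hq1 : q ≤ 1 := hle.trans (pow_le_one₀ hr.le hr1)
    have hbd : ∀ d w : ℝ, |d| ≤ √q / (3 * r) → 0 ≤ w → w ≤ 1 →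
        (1 + d) * (4 * deriv (deriv (profile r)) q * w + 2 * deriv (profile r) q) ≤
          8 * B := by
      intro d w hd hw0 hw1
      have hd' : |d| ≤ 1 / 3 := by
        refine hd.trans ?_
        rw [div_le_div_iff₀ (by positivity) (by norm_num)]
        linarith [(Real.sqrt_le_left hr.le).2 hle]
      have h3 : |1 + d| ≤ 4 / 3 := by
        rw [abs_le] at hd' ⊢
        constructor <;> linarith
      have h4 : |4 * deriv (deriv (profile r)) q * w + 2 * deriv (profile r) q| ≤ 6 * B := by
        refine (abs_add_le _ _).trans ?_
        rw [abs_mul, abs_mul, abs_mul, abs_of_nonneg hw0, abs_of_pos (by norm_num : (0 : ℝ) < 4),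
          abs_two]
        nlinarith [mul_le_mul h2 hw1 hw0 hB0]
      refine (le_abs_self _).trans ?_
      rw [abs_mul]
      calc _ ≤ 4 / 3 * (6 * B) := mul_le_mul h3 h4 (abs_nonneg _) (by norm_num)
        _ = 8 * B := by ring
    linarith [hbd d₁ x hb₁ hx0 (by nlinarith [sq_nonneg ε]),
      hbd d₂ y hb₂ hy0 (by nlinarith [sq_nonneg ε])]
  · rw [deriv_deriv_profile_eq_zero hr hgt, deriv_profile_eq_zero hr hgt]
    linarith

/-! ### The mean value inequality -/

theorem toReal_eLpNorm_two {μ : Measure Plane} {F : Plane → ℝ} (hF : MemLp F 2 μ) :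
    (eLpNorm F 2 μ).toReal = √(∫ s, F s ^ 2 ∂μ) := by
  rw [hF.eLpNorm_eq_integral_rpow_norm (by norm_num) (by norm_num),
    ENNReal.toReal_ofReal (by positivity), Real.sqrt_eq_rpow]
  simp

theorem integrable_indicator_four_div_norm (r : ℝ) :
    Integrable ((ball (0 : Plane) r).indicator fun s => 4 / ‖s‖) := by
  rw [integrable_indicator_iff measurableSet_ball]
  refine (integrableOn_fun_norm_addHaar volume (f := fun y => 4 / y)).2 ?_
  refine (integrableOn_const (C := (4 : ℝ)) (by simp)).congr_fun (fun y hy => ?_)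
    measurableSet_Ioo
  have : y ≠ 0 := hy.1.ne'
  simp only [finrank_euclideanSpace, Fintype.card_fin, smul_eq_mul]
  field_simp
  ring

/-- The barriers are bounded in `L²`, independently of their pole and scale. -/
theorem toReal_eLpNorm_barrier_le {φ : Plane → ℝ} {z : Plane} {r : ℝ} (hφ : IsTestFunction φ)
    (hfar : ∀ s, s ∉ ball z r → φ s = 0) (hsq : ∀ s, s ≠ z → φ s ^ 2 ≤ 4 / ‖s - z‖) :
    (eLpNorm φ 2 squareMeasure).toReal ≤
      √(∫ s, (ball (0 : Plane) r).indicator (fun s => 4 / ‖s‖) s) := by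
  rw [toReal_eLpNorm_two (hφ.memLp 2),
    integral_squareMeasure_eq fun s hs => by rw [hφ.eq_zero hs, zero_pow two_ne_zero],
    
    ← integral_sub_right_eq_self ((ball (0 : Plane) r).indicator fun s => 4 / ‖s‖) z]
  refine Real.sqrt_le_sqrt (integral_mono_of_nonneg (.of_forall fun s => sq_nonneg _)
    ((integrable_indicator_four_div_norm r).comp_sub_right z) ?_)
  filter_upwards [compl_mem_ae_iff.2 (measure_singleton z)] with s hs
  by_cases h : s ∈ ball z r
  · have h' : s - z ∈ ball (0 : Plane) r := by
      rwa [mem_ball_zero_iff, ← dist_eq_norm, ← mem_ball]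
    rw [indicator_of_mem h']
    exact hsq s hs
  · rw [hfar s h, zero_pow two_ne_zero]
    exact indicator_nonneg (fun _ _ => by positivity) _

theorem setIntegral_squareMeasure {B : Set Plane} (hB : MeasurableSet B) (hBs : B ⊆ unitSquare)
    (w : Plane → ℝ) : ∫ s in B, w s ∂squareMeasure = ∫ s in B, w s := by
  rw [squareMeasure, Measure.restrict_restrict hB, inter_eq_left.2 hBs]

/-- Integrating Kato's inequality against a barrier bounds the mean of `|u|` over a small ball. -/
theorem integral_closedBall_abs_le {α₁ α₂ : ℝ} {V f u φ : Plane → ℝ}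
    (hV : Integrable V squareMeasure) (hV0 : ∀ᵐ s ∂squareMeasure, 0 ≤ V s)
    (hf : MemLp f 2 squareMeasure) (hu : IsWeakSolution α₁ α₂ V f u) (hφ : IsTestFunction φ)
    (hφ0 : ∀ s, 0 ≤ φ s) {z : Plane} {r ε C κ : ℝ} (hεr : ε ≤ r)
    (hz : closedBall z r ⊆ unitSquare)
    (hL : ∀ s ∈ unitSquare, principalPart α₁ α₂ φ s ≤
      (closedBall z r).indicator (fun _ => C) s - (closedBall z ε).indicator (fun _ => κ) s) :
    κ * ∫ s in closedBall z ε, |u s| ≤ C * (∫ s in closedBall z r, |u s|) +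
      (eLpNorm f 2 squareMeasure).toReal * (eLpNorm φ 2 squareMeasure).toReal := by
  have hu2 := hu.1.1.1.memLp
  have hu1 : Integrable (fun s => |u s|) squareMeasure :=
    (hu2.integrable (by norm_num)).abs
  have hkato := hu.integral_abs_le hV hV0 hf hφ hφ0
  have hfφ : ∫ s, |f s| * φ s ∂squareMeasure ≤
      (eLpNorm f 2 squareMeasure).toReal * (eLpNorm φ 2 squareMeasure).toReal := by
    have h := abs_integral_mul_le_eLpNorm_mul_eLpNorm hf.abs (hφ.memLp 2)
    have e : eLpNorm (|f|) 2 squareMeasure = eLpNorm f 2 squareMeasure := eLpNorm_norm f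
    rw [e] at h
    exact (le_abs_self _).trans h
  have hind : ∀ ρ a : ℝ, ρ ≤ r → Integrable ((closedBall z ρ).indicator fun s => a * |u s|)
      squareMeasure ∧ ∫ s, (closedBall z ρ).indicator (fun s => a * |u s|) s ∂squareMeasure =
        a * ∫ s in closedBall z ρ, |u s| := by
    intro ρ a hρ
    refine ⟨(hu1.const_mul a).indicator measurableSet_closedBall, ?_⟩
    rw [integral_indicator measurableSet_closedBall, integral_const_mul,
      setIntegral_squareMeasure measurableSet_closedBall
        ((closedBall_subset_closedBall hρ).trans hz)]
  have hmono : ∫ s, |u s| * principalPart α₁ α₂ φ s ∂squareMeasure ≤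
      ∫ s, ((closedBall z r).indicator (fun s => C * |u s|) s -
        (closedBall z ε).indicator (fun s => κ * |u s|) s) ∂squareMeasure := by
    refine integral_mono_ae (hu2.abs.integrable_mul (hφ.memLp_principalPart α₁ α₂ 2))
      ((hind r C le_rfl).1.sub (hind ε κ hεr).1) ?_
    filter_upwards [ae_mem_unitSquare] with s hs
    refine (mul_le_mul_of_nonneg_left (hL s hs) (abs_nonneg _)).trans (le_of_eq ?_)
    by_cases h1 : s ∈ closedBall z r <;> by_cases h2 : s ∈ closedBall z ε <;>
      simp [h1, h2] <;> ring
  rw [integral_sub (hind r C le_rfl).1 (hind ε κ hεr).1, (hind r C le_rfl).2,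
    (hind ε κ hεr).2] at hmono
  linarith

theorem sub_le_coord {s₀ z : Plane} {r : ℝ} (hr : 0 < r)
    (hball : closure (ball s₀ (4 * r)) ⊆ unitSquare) (hz : z ∈ ball s₀ r) (i : Fin 2) :
    3 * r ≤ z i := by
  rw [closure_ball s₀ (by positivity)] at hball
  have hmem : s₀ - EuclideanSpace.single i (4 * r) ∈ closedBall s₀ (4 * r) := by
    rw [mem_closedBall, dist_eq_norm, sub_sub_cancel_left, norm_neg, PiLp.norm_single,
      Real.norm_of_nonneg (by positivity)]
  have h1 := pos_of_mem_unitSquare (hball hmem) i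
  rw [PiLp.sub_apply, PiLp.single_apply, if_pos rfl] at h1
  have h2 := abs_coord_sub_le z s₀ i
  rw [mem_ball, dist_eq_norm] at hz
  linarith [(abs_le.1 h2).1]

/-- The local maximum principle with a real constant. -/
theorem exists_forall_ae_abs_le {α₁ α₂ r : ℝ} (hα₁ : 0 ≤ α₁ ∧ α₁ ≤ 1 / 2)
    (hα₂ : 0 ≤ α₂ ∧ α₂ ≤ 1 / 2) {s₀ : Plane} (hr : 0 < r)
    (hball : closure (ball s₀ (4 * r)) ⊆ unitSquare) : ∃ C : ℝ, 0 < C ∧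
      ∀ V f u : Plane → ℝ, Integrable V squareMeasure → (∀ᵐ s ∂squareMeasure, 0 ≤ V s) →
        MemLp f 2 squareMeasure → IsWeakSolution α₁ α₂ V f u →
        ∀ᵐ z, z ∈ ball s₀ r → |u z| ≤
          C * ((eLpNorm u 2 (volume.restrict (ball s₀ (2 * r)))).toReal +
            (eLpNorm f 2 squareMeasure).toReal) := by
  have hsq : closedBall s₀ (4 * r) ⊆ unitSquare := by
    rwa [closure_ball s₀ (by positivity)] at hball
  have hr1 : r ≤ 1 := by
    have h1 := sub_le_coord hr hball (mem_ball_self hr) 0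
    have h2 := lt_one_of_mem_unitSquare (hsq (mem_closedBall_self (by positivity))) 0
    linarith
  obtain ⟨C, κ, ε₀, hC, hκ, hε₀, hε₀r, hbar⟩ := exists_barrier hα₁ hα₂ hr hr1
  set D := √(∫ s, (ball (0 : Plane) r).indicator (fun s => 4 / ‖s‖) s) with hD
  set N := (eLpNorm (fun _ : Plane => (1 : ℝ)) 2 (volume.restrict (ball s₀ (2 * r)))).toReal
    with hN
  set v := volume.real (ball (0 : Plane) 1) with hv
  have hv0 : 0 < v := ENNReal.toReal_pos (measure_ball_pos _ _ one_pos).ne' measure_ball_lt_top.ne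
  have hD0 : 0 ≤ D := Real.sqrt_nonneg _
  have hN0 : 0 ≤ N := ENNReal.toReal_nonneg
  have h2r : ball s₀ (2 * r) ⊆ unitSquare :=
    (ball_subset_closedBall.trans (closedBall_subset_closedBall (by linarith))).trans hsq
  refine ⟨(C * N + D) / (κ * v) + 1, by positivity, fun V f u hV hV0 hf hu => ?_⟩
  have hu2 := hu.1.1.1.memLp
  have hu2r : MemLp u 2 (volume.restrict (ball s₀ (2 * r))) :=
    hu2.mono_measure (Measure.restrict_mono_set _ h2r)
  have hfin : IsFiniteMeasure (volume.restrict (ball s₀ (2 * r))) :=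
    isFiniteMeasure_restrict.2 measure_ball_lt_top.ne
  set U := (eLpNorm u 2 (volume.restrict (ball s₀ (2 * r)))).toReal with hU
  set F := (eLpNorm f 2 squareMeasure).toReal with hF
  have hU0 : 0 ≤ U := ENNReal.toReal_nonneg
  have hF0 : 0 ≤ F := ENNReal.toReal_nonneg
  have hL1 : ∫ s in ball s₀ (2 * r), |u s| ≤ U * N := by
    have h := abs_integral_mul_le_eLpNorm_mul_eLpNorm hu2r.abs
      (memLp_const (1 : ℝ) (p := 2) (μ := volume.restrict (ball s₀ (2 * r))))
    have e : eLpNorm (|u|) 2 (volume.restrict (ball s₀ (2 * r))) = eLpNorm u 2 _ :=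
      eLpNorm_norm u
    simp only [e, mul_one] at h
    exact (le_abs_self _).trans h
  have hloc : LocallyIntegrable (unitSquare.indicator fun s => |u s|) :=
    ((integrable_indicator_iff isOpen_unitSquare.measurableSet).2
      (hu2.integrable (by norm_num)).abs).locallyIntegrable
  filter_upwards [IsUnifLocDoublingMeasure.ae_tendsto_average volume hloc 1] with z hz hzb
  have hzr : closedBall z r ⊆ ball s₀ (2 * r) := fun s hs => by
    rw [mem_ball] at hzb ⊢
    rw [mem_closedBall] at hs
    linarith [dist_triangle s z s₀]
  have hzs := hzr.trans h2r
  set δ : ℕ → ℝ := fun n => ε₀ / 2 * (1 / ((n : ℝ) + 1)) with hδ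
  have hδ0 : ∀ n, 0 < δ n := fun n => by positivity
  have hδlt : ∀ n, δ n < ε₀ := fun n => by
    have h : 1 / ((n : ℝ) + 1) ≤ 1 := by
      rw [div_le_one (by positivity)]; linarith [n.cast_nonneg (α := ℝ)]
    have := mul_le_mul_of_nonneg_left h (by positivity : 0 ≤ ε₀ / 2)
    simp only [hδ]
    linarith
  have hδt : Tendsto δ atTop (𝓝[>] 0) := by
    refine tendsto_nhdsWithin_iff.2 ⟨?_, .of_forall hδ0⟩
    simpa [hδ] using (tendsto_one_div_add_atTop_nhds_zero_nat (𝕜 := ℝ)).const_mul (ε₀ / 2)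
  have hlim := hz (fun _ : ℕ => z) δ hδt
    (.of_forall fun n => mem_closedBall_self (by have := hδ0 n; positivity))
  rw [indicator_of_mem (hzs (mem_closedBall_self hr.le))] at hlim
  refine le_of_tendsto' hlim fun n => ?_
  obtain ⟨φ, hφ, hφ0, hfar, hsqφ, hLφ⟩ :=
    hbar z hzs (sub_le_coord hr hball hzb) (δ n) (hδ0 n) (hδlt n)
  have hδr : δ n ≤ r := (hδlt n).le.trans hε₀r
  have hmean := integral_closedBall_abs_le hV hV0 hf hu hφ hφ0 hδr hzs hLφ
  have hφD := toReal_eLpNorm_barrier_le hφ hfar hsqφ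
  have hCle : C * ∫ s in closedBall z r, |u s| ≤ C * (U * N) := by
    refine mul_le_mul_of_nonneg_left ((setIntegral_mono_set ?_
      (.of_forall fun s => abs_nonneg _) hzr.eventuallyLE).trans hL1) hC
    exact (hu2r.integrable (by norm_num)).abs
  have hvol : volume.real (closedBall z (δ n)) = δ n ^ 2 * v := by
    rw [Measure.addHaar_real_closedBall _ _ (hδ0 n).le]
    simp [hv]
  have hint : ∫ s in closedBall z (δ n), unitSquare.indicator (fun s => |u s|) s =
      ∫ s in closedBall z (δ n), |u s| :=
    setIntegral_congr_fun measurableSet_closedBall fun s hs =>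
      indicator_of_mem (hzs (closedBall_subset_closedBall hδr hs)) _
  rw [setAverage_eq, hint, hvol, smul_eq_mul]
  have hδne : δ n ≠ 0 := (hδ0 n).ne'
  have hI : ∫ s in closedBall z (δ n), |u s| = κ / δ n ^ 2 *
      (∫ s in closedBall z (δ n), |u s|) * (δ n ^ 2 / κ) := by
    field_simp
  -- The factor `ε⁻²` of the barrier matches the area of the ball.
  have hbound : κ / δ n ^ 2 * ∫ s in closedBall z (δ n), |u s| ≤ (C * N + D) * (U + F) := by
    have h1 := mul_le_mul_of_nonneg_left hφD hF0
    nlinarith [mul_nonneg (mul_nonneg hC hN0) hF0, mul_nonneg hD0 hU0]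
  rw [hI]
  calc (δ n ^ 2 * v)⁻¹ * (κ / δ n ^ 2 * (∫ s in closedBall z (δ n), |u s|) * (δ n ^ 2 / κ))
      ≤ (δ n ^ 2 * v)⁻¹ * ((C * N + D) * (U + F) * (δ n ^ 2 / κ)) := by gcongr
    _ = (C * N + D) / (κ * v) * (U + F) := by field_simp
    _ ≤ ((C * N + D) / (κ * v) + 1) * (U + F) := by gcongr; linarith

end SubElliptic

theorem theorem202210292227 (α₁ α₂ : ℝ) (hα₁ : 0 < α₁ ∧ α₁ < 1 / 2) (hα₂ : 0 < α₂ ∧ α₂ < 1 / 2)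
    (p : ℝ≥0∞) (hp : 1 < p) (hp' : p < ⊤) (M : ℝ≥0)
    (s₀ : SubElliptic.Plane) (r : ℝ) (hr : 0 < r)
    (hball : closure (Metric.ball s₀ (4 * r)) ⊆ SubElliptic.unitSquare) :
    ∃ C : ℝ≥0, 0 < C ∧
      ∀ V f u : SubElliptic.Plane → ℝ,
        MeasureTheory.MemLp V p SubElliptic.squareMeasure →
        MeasureTheory.eLpNorm V p SubElliptic.squareMeasure ≤ M →
        (∀ᵐ s ∂SubElliptic.squareMeasure, 0 ≤ V s) →
        MeasureTheory.MemLp f 2 SubElliptic.squareMeasure →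
        SubElliptic.IsWeakSolution α₁ α₂ V f u →
        essSup (fun s => ‖u s‖ₑ) (MeasureTheory.volume.restrict (Metric.ball s₀ r)) ≤
          C * (MeasureTheory.eLpNorm u 2 (MeasureTheory.volume.restrict (Metric.ball s₀ (2 * r))) +
            MeasureTheory.eLpNorm f 2 SubElliptic.squareMeasure) := by
  obtain ⟨C, hC, h⟩ := SubElliptic.exists_forall_ae_abs_le ⟨hα₁.1.le, hα₁.2.le⟩
    ⟨hα₂.1.le, hα₂.2.le⟩ hr hball
  refine ⟨C.toNNReal, Real.toNNReal_pos.2 hC, fun V f u hV _ hV0 hf hu => ?_⟩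
  have hae := h V f u (hV.integrable hp.le) hV0 hf hu
  have h2r : ball s₀ (2 * r) ⊆ SubElliptic.unitSquare :=
    (subset_closure.trans (closure_mono (ball_subset_ball (by linarith)))).trans hball
  have hu2 : MemLp u 2 (volume.restrict (ball s₀ (2 * r))) :=
    hu.1.1.1.memLp.mono_measure (Measure.restrict_mono_set _ h2r)
  refine essSup_le_of_ae_le _ ?_
  filter_upwards [(ae_restrict_iff' measurableSet_ball).2 hae] with z hz
  rw [← ofReal_norm, Real.norm_eq_abs]
  refine (ENNReal.ofReal_le_ofReal hz).trans (le_of_eq ?_)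
  rw [ENNReal.ofReal_mul hC.le, ENNReal.ofReal_add ENNReal.toReal_nonneg ENNReal.toReal_nonneg,
    ENNReal.ofReal_toReal hu2.2.ne, ENNReal.ofReal_toReal hf.2.ne]
  rfl
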